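/- **Proposition (Revenue estimation).** Let $K,N\ge 1$ be integers, $R>0$, $\varepsilon>0$, and for $k=1,\dots,K$ let $a_k>0$, $b_k,d_k\ge 0$ with $-a_kb_k^3+d_k\ge 0$. Define the offer prices $$f_k(\xi)=\begin{cases}a_k(\xi-b_k)^3+d_k,&0\le\xi\le b_k,\\ d_k,&\xi>b_k.\end{cases}$$ Let $\Xi=[0,R]$, let $\widehat\xi_1,\dots,\widehat\xi_N\in\Xi$, let $\widehat{\mathbb P}=\frac1N\sum_{i=1}^N\delta_{\widehat\xi_i}$, and let $\mathbb B_\varepsilon(\widehat{\mathbb P})$ be the set of Borel probability measures $\mathbb Q$ on $\Xi$ with $d_W(\mathbb Q,\widehat{\mathbb P})\le\varepsilon$, where $d_W(\mathbb Q,\mathbb P)=\inf_\Pi\big(\int_{\Xi\times\Xi}|\xi-\xi'|^2\,\Pi(d\xi,d\xi')\big)^{1/2}$ over all joint distributions $\Pi$ on $\Xi\times\Xi$ with marginals $\mathbb Q$ and $\mathbb P$. Consider $$(\mathrm{RP})\qquad \max_{\mathbb Q\in\mathbb B_\varepsilon(\widehat{\mathbb P})}\ \mathbb E^{\mathbb Q}\Big[\max_{1\le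 k\le K}f_k(\xi)\Big].$$ Let $g^{(k)}_1(\xi)=-a_k(\xi-b_k)^3-d_k$, $g^{(k)}_2(\xi)=-d_k$, $h_1(\xi)=\xi$, $h_2(\xi)=R-\xi$, and let $\tau^{(k)}_1,\tau^{(k)}_2\in\mathbb R$ satisfy $\tau_2^{(k)}<g^{(k)}_j(\xi)<\tau_1^{(k)}$ for all $\xi\in[0,R]$ and $j\in\{1,2\}$. In $\mathbb R[\xi,\widetilde\xi]$ put $\widetilde g^{(k)}_j=\widetilde\xi-g^{(k)}_j(\xi)$ for $j=1,2$, $\widetilde g^{(k)}_3=\tau^{(k)}_1-\widetilde\xi$ and $\widetilde g^{(k)}_4=\widetilde\xi-\tau^{(k)}_2$. Write $\Sigma^2$ for the sums of squares in $\mathbb R[\xi,\widetilde\xi]$ and $\Sigma^2_{2r}$ for those of total degree at most $2r$. For $r\in\mathbb N$ let $(\mathrm{RD}_r)$ be the problem of minimizing $$\lambda\varepsilon^2-\frac1N\sum_{i=1}^N\alpha_i$$ over $\lambda\ge0$, $\alpha_i\in\mathbb R$ and $\sigma^{(k)}_{\ell,i},\eta^{(k)}_{j,i}\in\Sigma^2$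 ($1\le k\le K$, $1\le i\le N$, $\ell\in\{1,2\}$, $j\in\{1,2,3,4\}$) subject to, for all $k,i,\ell,j$, $$\widetilde\xi+\lambda(\xi-\widehat\xi_i)^2-\alpha_i-\sum_{\ell'=1}^2\sigma^{(k)}_{\ell',i}h_{\ell'}-\sum_{j'=1}^4\eta^{(k)}_{j',i}\widetilde g^{(k)}_{j'}\in\Sigma^2_{2r},\qquad \deg(\sigma^{(k)}_{\ell,i}h_\ell)\le 2r,\qquad \deg(\eta^{(k)}_{j,i}\widetilde g^{(k)}_j)\le 2r.$$ Then the maximum in $(\mathrm{RP})$ and, for every $r\ge2$, the minimum in $(\mathrm{RD}_r)$ are attained, $$\min(\mathrm{RD}_r)\ \ge\ \min(\mathrm{RD}_{r+1})\ \ge\ \max(\mathrm{RP})\qquad\text{for } r=2,3,4,\dots,$$ and $\lim_{r\to\infty}\min(\mathrm{RD}_r)=\max(\mathrm{RP})$. -/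

import Mathlib

open MeasureTheory Filter Topology
open scoped ENNReal

noncomputable section

namespace RevenueEstimation

/-- The quadratic (order 2) Wasserstein distance between two measures on a metric space: the
infimum, over all joint distributions `π` with marginals `μ` and `ν`, of
`(∫ dist (x, y) ^ 2 dπ(x, y)) ^ (1 / 2)`. A `π` with a probability measure as marginal is
automatically a probability measure. -/
def wassersteinDist {X : Type*} [PseudoEMetricSpace X] [MeasurableSpace X]
    (μ ν : Measure X) : ℝ≥0∞ :=
  ⨅ (π : Measure (X × X)) (_ : π.map Prod.fst = μ ∧ π.map Prod.snd = ν),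
    (∫⁻ p, edist p.1 p.2 ^ 2 ∂π) ^ (1 / 2 : ℝ)

/-- The empirical distribution `(1 / N) ∑ i, δ_{x i}`. -/
def empirical {X : Type*} [MeasurableSpace X] {N : ℕ} (x : Fin N → X) : Measure X :=
  (N : ℝ≥0∞)⁻¹ • ∑ i, Measure.dirac (x i)

/-- The Wasserstein ball of radius `ε` around `P`, inside the probability measures on `X`. -/
def wassersteinBall {X : Type*} [PseudoEMetricSpace X] [MeasurableSpace X]
    (P : Measure X) (ε : ℝ) : Set (Measure X) :=
  {Q | IsProbabilityMeasure Q ∧ wassersteinDist Q P ≤ ENNReal.ofReal ε}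

/-- The offer price of a customer with parameters `a, b, d` for the quantity `x ≥ 0`. -/
def offerPrice (a b d x : ℝ) : ℝ :=
  if x ≤ b then a * (x - b) ^ 3 + d else d

/-- The revenue `max_k f_k(x)`. -/
def revenue {K : ℕ} (a b d : Fin K → ℝ) (x : ℝ) : ℝ :=
  ⨆ k, offerPrice (a k) (b k) (d k) x

/-- The expected revenues `E^Q[max_k f_k(ξ)]` for `Q` in the Wasserstein ball of radius `ε` around
the empirical distribution of the data, all distributions being supported on `[0, R]`. -/
def expectedRevenues (R ε : ℝ) {K N : ℕ} (a b d : Fin K → ℝ) (data : Fin N → Set.Icc (0 : ℝ) R) :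
    Set ℝ :=
  {v | ∃ Q ∈ wassersteinBall (empirical data) ε,
    v = ∫ x : Set.Icc (0 : ℝ) R, revenue a b d (x : ℝ) ∂Q}

/-- The two univariate polynomials `-a (ξ - b)^3 - d` and `-d` of a customer. -/
def lossPoly (a b d : ℝ) : Fin 2 → Polynomial ℝ :=
  ![-(Polynomial.C a * (Polynomial.X - Polynomial.C b) ^ 3) - Polynomial.C d, -Polynomial.C d]

/-- The polynomial ring in the two variables `ξ` (index `0`) and `ξ̃` (index `1`). -/
abbrev LiftedPoly : Type := MvPolynomial (Fin 2) ℝ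

/-- The variable `ξ`. -/
def xi : LiftedPoly := MvPolynomial.X 0

/-- The lifting variable `ξ̃`. -/
def xiTilde : LiftedPoly := MvPolynomial.X 1

/-- The polynomials `h₁ = ξ` and `h₂ = R - ξ` describing `[0, R]`. -/
def supportPoly (R : ℝ) : Fin 2 → LiftedPoly :=
  ![xi, MvPolynomial.C R - xi]

/-- The polynomials `ξ̃ - g₁(ξ)`, `ξ̃ - g₂(ξ)`, `τ₁ - ξ̃`, `ξ̃ - τ₂` of a customer. -/
def liftedPoly (a b d τ₁ τ₂ : ℝ) : Fin 4 → LiftedPoly :=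
  ![xiTilde - Polynomial.aeval xi (lossPoly a b d 0),
    xiTilde - Polynomial.aeval xi (lossPoly a b d 1),
    MvPolynomial.C τ₁ - xiTilde,
    xiTilde - MvPolynomial.C τ₂]

/-- Feasibility of `(lam, α, σ, η)` for the relaxation of order `r`: `lam ≥ 0`, all multipliers are
sums of squares within the degree bounds, and for all `k, i` the polynomial
`ξ̃ + lam (ξ - x_i)^2 - α_i - ∑ ℓ, σ_ℓ h_ℓ - ∑ j, η_j g̃_j` is a sum of squares of degree at
most `2 r`. -/
structure RelaxationFeasible (R : ℝ) {K N : ℕ} (a b d τ₁ τ₂ : Fin K → ℝ)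
    (data : Fin N → Set.Icc (0 : ℝ) R) (r : ℕ) (lam : ℝ) (α : Fin N → ℝ)
    (σ : Fin K → Fin N → Fin 2 → LiftedPoly) (η : Fin K → Fin N → Fin 4 → LiftedPoly) :
    Prop where
  lam_nonneg : 0 ≤ lam
  isSumSq_σ : ∀ k i ℓ, IsSumSq (σ k i ℓ)
  isSumSq_η : ∀ k i j, IsSumSq (η k i j)
  isSumSq_remainder : ∀ k i, IsSumSq
    (xiTilde + MvPolynomial.C lam * (xi - MvPolynomial.C (data i : ℝ)) ^ 2
      - MvPolynomial.C (α i) - ∑ ℓ, σ k i ℓ * supportPoly R ℓ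
      - ∑ j, η k i j * liftedPoly (a k) (b k) (d k) (τ₁ k) (τ₂ k) j)
  degree_remainder : ∀ k i,
    (xiTilde + MvPolynomial.C lam * (xi - MvPolynomial.C (data i : ℝ)) ^ 2
      - MvPolynomial.C (α i) - ∑ ℓ, σ k i ℓ * supportPoly R ℓ
      - ∑ j, η k i j * liftedPoly (a k) (b k) (d k) (τ₁ k) (τ₂ k) j).totalDegree ≤ 2 * r
  degree_σ : ∀ k i ℓ, (σ k i ℓ * supportPoly R ℓ).totalDegree ≤ 2 * r
  degree_η : ∀ k i j,
    (η k i j * liftedPoly (a k) (b k) (d k) (τ₁ k) (τ₂ k) j).totalDegree ≤ 2 * r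

/-- The objective values `lam ε^2 - (1 / N) ∑ i, α_i` of the feasible points of the relaxation of
order `r`. -/
def relaxationValues (R ε : ℝ) {K N : ℕ} (a b d τ₁ τ₂ : Fin K → ℝ)
    (data : Fin N → Set.Icc (0 : ℝ) R) (r : ℕ) : Set ℝ :=
  {v | ∃ (lam : ℝ) (α : Fin N → ℝ) (σ : Fin K → Fin N → Fin 2 → LiftedPoly)
      (η : Fin K → Fin N → Fin 4 → LiftedPoly),
    RelaxationFeasible R a b d τ₁ τ₂ data r lam α σ η ∧
      v = lam * ε ^ 2 - (1 / (N : ℝ)) * ∑ i, α i}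

end RevenueEstimation

end

/-! The Lagrangian dual of the worst-case problem minimises `lam * ε ^ 2 - (1 / N) * ∑ i, α i`
subject to `revenue a b d x ≤ lam * |x - x_i| ^ 2 - α i` on `[0, R]`. Weak duality integrates this
inequality against couplings (`integral_le_dual`). Strong duality is a planar statement: moving the
atoms of the empirical measure produces points (cost, value), whose convex hull is compact and is
realised by couplings. Maximising the value over the hull gives an optimal distribution, and
separating the hull from a quadrant gives an optimal multiplier (`exists_worstCase_and_multiplier`).

On `[0, R]` each `-f_k` is the maximum of the two polynomials `g_j`. The dual constraint therefore
says that `ξ̃ + lam * (ξ - x_i) ^ 2 - α i` is nonnegative on the compact lifted set cut out by `h_ℓ`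
and `g̃_j`. The relaxation asks instead for membership in the truncated quadratic module; this is
sufficient, and it weakens as `r` grows, whence the upper bounds and their monotonicity. For
convergence, lowering every `α i` by a small amount makes the constraints strict, and strict
constraints have certificates of some finite degree (`add_aeval_mem_quadraticModule`). That
certificate is built by hand from univariate positivity on an interval
(`mem_intervalModule_of_pos`).

The relaxations attain their minima because truncated modules are closed when the generators are
simultaneously positive somewhere (`isClosed_setOf_mem_truncatedModule`), and because sublevel sets
of the objective are bounded. -/

namespace RevenueEstimation

/-! ### Univariate Positivstellensatz on an interval. -/

section IntervalPositivity

open Polynomial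

/-- The quadratic module of `ℝ[X]` generated by `X - A` and `B - X`. -/
def intervalModule (A B : ℝ) : Set ℝ[X] :=
  {u | ∃ s₀ s₁ s₂ : ℝ[X], IsSumSq s₀ ∧ IsSumSq s₁ ∧ IsSumSq s₂ ∧
    u = s₀ + s₁ * (X - C A) + s₂ * (C B - X)}

lemma isSumSq_C {c : ℝ} (hc : 0 ≤ c) : IsSumSq (C c : ℝ[X]) := by
  have : (C c : ℝ[X]) = C (√c) * C (√c) := by rw [← C_mul, Real.mul_self_sqrt hc]
  rw [this]; exact IsSumSq.mul_self _

lemma mem_intervalModule_of_isSumSq {A B : ℝ} {s : ℝ[X]} (hs : IsSumSq s) :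
    s ∈ intervalModule A B :=
  ⟨s, 0, 0, hs, .zero, .zero, by ring⟩

/-- Only the mixed product needs an argument. Since `(X - A) + (B - X) = B - A` is a positive
constant, `(X - A) * (B - X)` equals `(B - A)⁻¹` times `(B - X)² * (X - A) + (X - A)² * (B - X)`. -/
lemma mul_mem_intervalModule {A B : ℝ} (hAB : A < B) {u v : ℝ[X]}
    (hu : u ∈ intervalModule A B) (hv : v ∈ intervalModule A B) :
    u * v ∈ intervalModule A B := by
  obtain ⟨s₀, s₁, s₂, hs₀, hs₁, hs₂, rfl⟩ := hu
  obtain ⟨t₀, t₁, t₂, ht₀, ht₁, ht₂, rfl⟩ := hv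
  have hm : IsSumSq (s₁ * t₂ + s₂ * t₁) := (hs₁.mul ht₂).add (hs₂.mul ht₁)
  have hc : IsSumSq (C (B - A)⁻¹ : ℝ[X]) := isSumSq_C (inv_nonneg.2 (sub_nonneg.2 hAB.le))
  have hC : (C (B - A)⁻¹ : ℝ[X]) * (C B - C A) = 1 := by
    rw [← C_sub, ← C_mul, inv_mul_cancel₀ (sub_ne_zero.2 hAB.ne'), C_1]
  refine ⟨s₀ * t₀ + s₁ * t₁ * ((X - C A) * (X - C A)) + s₂ * t₂ * ((C B - X) * (C B - X)),
    s₀ * t₁ + s₁ * t₀ + (s₁ * t₂ + s₂ * t₁) * C (B - A)⁻¹ * ((C B - X) * (C B - X)),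
    s₀ * t₂ + s₂ * t₀ + (s₁ * t₂ + s₂ * t₁) * C (B - A)⁻¹ * ((X - C A) * (X - C A)),
    ((hs₀.mul ht₀).add ((hs₁.mul ht₁).mul (.mul_self _))).add ((hs₂.mul ht₂).mul (.mul_self _)),
    ((hs₀.mul ht₁).add (hs₁.mul ht₀)).add ((hm.mul hc).mul (.mul_self _)),
    ((hs₀.mul ht₂).add (hs₂.mul ht₀)).add ((hm.mul hc).mul (.mul_self _)), ?_⟩
  linear_combination (-(s₁ * t₂ + s₂ * t₁) * (X - C A) * (C B - X)) * hC

lemma eval_nonneg_of_isSumSq {s : ℝ[X]} (hs : IsSumSq s) (x : ℝ) : 0 ≤ s.eval x := by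
  induction hs with
  | zero => simp
  | sq_add a _ ih => simpa using add_nonneg (mul_self_nonneg (a.eval x)) ih

lemma eval_nonneg_of_mem_intervalModule {A B : ℝ} {u : ℝ[X]} (hu : u ∈ intervalModule A B)
    {x : ℝ} (hx : x ∈ Set.Icc A B) : 0 ≤ u.eval x := by
  obtain ⟨s₀, s₁, s₂, hs₀, hs₁, hs₂, rfl⟩ := hu
  have h₀ := eval_nonneg_of_isSumSq hs₀ x
  have h₁ := mul_nonneg (eval_nonneg_of_isSumSq hs₁ x) (sub_nonneg.2 hx.1)
  have h₂ := mul_nonneg (eval_nonneg_of_isSumSq hs₂ x) (sub_nonneg.2 hx.2)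
  simp only [eval_add, eval_mul, eval_sub, eval_X, eval_C]
  linarith

lemma linear_mem_intervalModule {A B : ℝ} {c : ℝ} (hc : c ∉ Set.Icc A B) :
    X - C c ∈ intervalModule A B ∨ -(X - C c) ∈ intervalModule A B := by
  rw [Set.mem_Icc, not_and_or, not_le, not_le] at hc
  rcases hc with h | h
  · exact .inl ⟨C (A - c), 1, 0, isSumSq_C (by linarith), .one, .zero, by rw [C_sub]; ring⟩
  · exact .inr ⟨C (c - B), 0, 1, isSumSq_C (by linarith), .zero, .one, by rw [C_sub]; ring⟩

lemma mul_mem_or_neg_mem_intervalModule {A B : ℝ} (hAB : A < B) {u v : ℝ[X]}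
    (hu : u ∈ intervalModule A B ∨ -u ∈ intervalModule A B)
    (hv : v ∈ intervalModule A B ∨ -v ∈ intervalModule A B) :
    u * v ∈ intervalModule A B ∨ -(u * v) ∈ intervalModule A B := by
  rcases hu with hu | hu <;> rcases hv with hv | hv
  · exact .inl (mul_mem_intervalModule hAB hu hv)
  · right; simpa using mul_mem_intervalModule hAB hu hv
  · right; simpa using mul_mem_intervalModule hAB hu hv
  · left; simpa using mul_mem_intervalModule hAB hu hv

lemma C_mem_intervalModule {A B : ℝ} (c : ℝ) :
    C c ∈ intervalModule A B ∨ -C c ∈ intervalModule A B := by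
  rcases le_total 0 c with h | h
  · exact .inl (mem_intervalModule_of_isSumSq (isSumSq_C h))
  · right
    rw [← C_neg]
    exact mem_intervalModule_of_isSumSq (isSumSq_C (neg_nonneg.2 h))

lemma quadratic_mem_intervalModule {A B a b c : ℝ} (ha : a ≠ 0)
    (h : ∀ x, a * x ^ 2 + b * x + c ≠ 0) :
    C a * X ^ 2 + C b * X + C c ∈ intervalModule A B ∨
      -(C a * X ^ 2 + C b * X + C c) ∈ intervalModule A B := by
  have hdisc : discrim a b c < 0 := by
    by_contra! hd
    obtain ⟨x, hx⟩ := exists_quadratic_eq_zero ha ⟨√(discrim a b c), (Real.mul_self_sqrt hd).symm⟩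
    exact h x (by rw [← hx]; ring)
  have hk : 0 ≤ c / a - (b / (2 * a)) ^ 2 := by
    have : c / a - (b / (2 * a)) ^ 2 = -discrim a b c / (4 * a ^ 2) := by
      rw [discrim]; field_simp; ring
    rw [this]
    exact div_nonneg (by linarith) (by positivity)
  set m := b / (2 * a) with hm
  set k := c / a - m ^ 2 with hkdef
  have hsos : IsSumSq ((X + C m) * (X + C m) + C k : ℝ[X]) :=
    (IsSumSq.mul_self _).add (isSumSq_C hk)
  have hfac : C a * X ^ 2 + C b * X + C c = C a * ((X + C m) * (X + C m) + C k) := by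
    have h1 : b = 2 * a * m := by rw [hm]; field_simp
    have h2 : c = a * (m ^ 2 + k) := by rw [hkdef]; field_simp; ring
    rw [h2, h1]; simp only [C_mul, C_add, C_pow]
    rw [show (C 2 : ℝ[X]) = 2 from rfl]; ring
  rw [hfac]
  rcases le_total 0 a with h0 | h0
  · exact .inl (mem_intervalModule_of_isSumSq ((isSumSq_C h0).mul hsos))
  · right
    rw [← neg_mul, ← C_neg]
    exact mem_intervalModule_of_isSumSq ((isSumSq_C (neg_nonneg.2 h0)).mul hsos)

/-- A real irreducible has degree at most two. With a root it is a unit times `X - c`, where `c`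
lies outside the interval; without one it is a quadratic of negative discriminant, hence a sum of
squares up to sign. -/
lemma irreducible_mem_intervalModule {A B : ℝ} (hAB : A < B) {p : ℝ[X]} (hp : Irreducible p)
    (h : ∀ x ∈ Set.Icc A B, p.eval x ≠ 0) :
    p ∈ intervalModule A B ∨ -p ∈ intervalModule A B := by
  by_cases hroot : ∃ c, p.eval c = 0
  · obtain ⟨c, hc⟩ := hroot
    obtain ⟨q, hq⟩ := dvd_iff_isRoot.2 hc
    have hunit : IsUnit q := (hp.isUnit_or_isUnit hq).resolve_left (not_isUnit_X_sub_C c)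
    obtain ⟨e, -, rfl⟩ := isUnit_iff.1 hunit
    rw [hq]
    exact mul_mem_or_neg_mem_intervalModule hAB (linear_mem_intervalModule fun hcm ↦ h c hcm hc)
      (C_mem_intervalModule e)
  · push Not at hroot
    have hdeg := hp.degree_le_two
    have hform := eq_quadratic_of_degree_le_two hdeg
    have hev : ∀ x, p.eval x = p.coeff 2 * x ^ 2 + p.coeff 1 * x + p.coeff 0 := fun x ↦ by
      conv_lhs => rw [hform]
      simp
    have ha : p.coeff 2 ≠ 0 := by
      intro h2
      by_cases h1 : p.coeff 1 = 0
      · refine hp.not_isUnit ?_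
        have hp0 : p = C (p.coeff 0) := by
          conv_lhs => rw [hform, h2, h1]
          simp
        have : p.coeff 0 ≠ 0 := fun h0 ↦ hp.ne_zero (by rw [hp0, h0, C_0])
        rw [hp0]
        exact isUnit_C.2 (isUnit_iff_ne_zero.2 this)
      · exact hroot (-p.coeff 0 / p.coeff 1) (by rw [hev, h2]; field_simp; ring)
    rw [hform]
    exact quadratic_mem_intervalModule ha fun x ↦ by rw [← hev]; exact hroot x

/-- Membership up to sign is multiplicative, so it can be checked on irreducible factors without
tracking their individual signs. -/
lemma mem_or_neg_mem_intervalModule {A B : ℝ} (hAB : A < B) (u : ℝ[X])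
    (h : ∀ x ∈ Set.Icc A B, u.eval x ≠ 0) :
    u ∈ intervalModule A B ∨ -u ∈ intervalModule A B := by
  induction u using WfDvdMonoid.induction_on_irreducible with
  | zero => exact .inl (mem_intervalModule_of_isSumSq .zero)
  | unit u hu =>
    obtain ⟨c, -, rfl⟩ := isUnit_iff.1 hu
    exact C_mem_intervalModule c
  | mul u p _ hp ih =>
    simp only [eval_mul, ne_eq, mul_eq_zero, not_or] at h
    exact mul_mem_or_neg_mem_intervalModule hAB (irreducible_mem_intervalModule hAB hp fun x hx ↦ (h x hx).1)
      (ih fun x hx ↦ (h x hx).2)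

/-- A univariate polynomial positive on `[A, B]` lies in the quadratic module of `[A, B]`. -/
theorem mem_intervalModule_of_pos {A B : ℝ} (hAB : A < B) {u : ℝ[X]}
    (h : ∀ x ∈ Set.Icc A B, 0 < u.eval x) : u ∈ intervalModule A B := by
  refine (mem_or_neg_mem_intervalModule hAB u fun x hx ↦ (h x hx).ne').resolve_right fun hneg ↦ ?_
  -- One evaluation settles the sign: elements of the module are nonnegative on the interval.
  have hA : A ∈ Set.Icc A B := Set.left_mem_Icc.2 hAB.le
  have := eval_nonneg_of_mem_intervalModule hneg hA
  rw [eval_neg] at this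
  linarith [h A hA]

end IntervalPositivity

/-! ### Compactness of convex hulls via Carathéodory. -/

section ConvexHull

/-- In finite dimension the convex hull of a compact set is compact. -/
theorem isCompact_convexHull {E : Type*} [NormedAddCommGroup E] [NormedSpace ℝ E]
    [FiniteDimensional ℝ E] {s : Set E} (hs : IsCompact s) : IsCompact (convexHull ℝ s) := by
  rcases s.eq_empty_or_nonempty with rfl | ⟨z₀, hz₀⟩
  · simp
  set n := Module.finrank ℝ E + 1
  have hcomp : IsCompact ((fun p : (Fin n → ℝ) × (Fin n → E) ↦ ∑ i, p.1 i • p.2 i) ''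
      (stdSimplex ℝ (Fin n) ×ˢ Set.univ.pi fun _ ↦ s)) :=
    ((isCompact_stdSimplex ℝ (Fin n)).prod (isCompact_univ_pi fun _ ↦ hs)).image (by fun_prop)
  convert hcomp using 1
  ext x
  constructor
  · intro hx
    obtain ⟨ι, _, z, w, hzs, hind, hw, hw1, rfl⟩ := eq_pos_convex_span_of_mem_convexHull hx
    obtain ⟨e⟩ := Function.Embedding.nonempty_of_card_le (α := ι) (β := Fin n) <| by
      have := hind.card_le_finrank_succ
      have h2 := Submodule.finrank_le (vectorSpan ℝ (Set.range z))
      simp only [Fintype.card_fin, n]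
      omega
    -- Carathéodory gives at most `n` points; the unused slots are padded with weight `0` at the
    -- arbitrary point `z₀`, so that one compact parameter space suffices.
    refine ⟨(Function.extend e w 0, Function.extend e z fun _ ↦ z₀), ⟨⟨fun i ↦ ?_, ?_⟩, ?_⟩, ?_⟩
    · by_cases hi : ∃ a, e a = i
      · obtain ⟨a, rfl⟩ := hi
        simpa [e.injective.extend_apply] using (hw a).le
      · simp [Function.extend_apply' _ _ _ hi]
    · rw [← hw1]
      refine (Finset.sum_of_injOn e e.injective.injOn (by simp) (fun i _ hi ↦ ?_) fun a _ ↦ ?_).symm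
      · exact Function.extend_apply' _ _ _ fun ⟨a, ha⟩ ↦ hi ⟨a, by simp, ha⟩
      · simp [e.injective.extend_apply]
    · intro i _
      by_cases hi : ∃ a, e a = i
      · obtain ⟨a, rfl⟩ := hi
        simpa [e.injective.extend_apply] using hzs ⟨a, rfl⟩
      · simpa [Function.extend_apply' _ _ _ hi] using hz₀
    · refine (Finset.sum_of_injOn e e.injective.injOn (by simp) (fun i _ hi ↦ ?_) fun a _ ↦ ?_).symm
      · simp [Function.extend_apply' _ _ _ fun ⟨a, ha⟩ ↦ hi ⟨a, by simp, ha⟩]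
      · simp [e.injective.extend_apply]
  · rintro ⟨p, ⟨⟨hp0, hp1⟩, hp2⟩, rfl⟩
    exact (convex_convexHull ℝ s).sum_mem (fun i _ ↦ hp0 i) hp1
      fun i _ ↦ subset_convexHull ℝ s (hp2 i trivial)

end ConvexHull

/-! ### Closedness of truncated quadratic modules. -/

section TruncatedModule

open MvPolynomial

variable {n : ℕ}

/-- A cancellation of top-degree terms would need leading coefficients of opposite sign. The order
`degLex` is used because it refines total degree. -/
lemma totalDegree_le_totalDegree_add {p q : MvPolynomial (Fin n) ℝ}
    (hp : 0 ≤ MonomialOrder.degLex.leadingCoeff p) (hq : 0 ≤ MonomialOrder.degLex.leadingCoeff q) :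
    p.totalDegree ≤ (p + q).totalDegree ∧ 0 ≤ MonomialOrder.degLex.leadingCoeff (p + q) := by
  by_cases hp0 : p = 0
  · subst hp0; simpa using hq
  rcases lt_trichotomy (MonomialOrder.degLex.toSyn (MonomialOrder.degLex.degree p))
    (MonomialOrder.degLex.toSyn (MonomialOrder.degLex.degree q)) with h | h | h
  · have hd := MonomialOrder.degLex.degree_add_eq_right_of_lt h
    refine ⟨degLex_totalDegree_monotone (by rw [hd]; exact h.le), ?_⟩
    rw [add_comm, MonomialOrder.leadingCoeff_add_of_lt h]
    exact hq
  · have heq := MonomialOrder.degLex.toSyn.injective h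
    have hc : coeff (MonomialOrder.degLex.degree p) (p + q) =
        MonomialOrder.degLex.leadingCoeff p + MonomialOrder.degLex.leadingCoeff q := by
      rw [coeff_add, MonomialOrder.leadingCoeff, MonomialOrder.leadingCoeff, heq]
    have hpos : 0 < coeff (MonomialOrder.degLex.degree p) (p + q) := by
      rw [hc]
      have : MonomialOrder.degLex.leadingCoeff p ≠ 0 :=
        MonomialOrder.degLex.leadingCoeff_ne_zero_iff.2 hp0
      have := lt_of_le_of_ne hp this.symm
      linarith
    have hle : MonomialOrder.degLex.toSyn (MonomialOrder.degLex.degree p) ≤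
        MonomialOrder.degLex.toSyn (MonomialOrder.degLex.degree (p + q)) :=
      MonomialOrder.degLex.le_degree (mem_support_iff.2 hpos.ne')
    refine ⟨degLex_totalDegree_monotone hle, ?_⟩
    have hge := MonomialOrder.degLex.degree_add_le (f := p) (g := q)
    rw [← h, sup_idem] at hge
    have : MonomialOrder.degLex.degree (p + q) = MonomialOrder.degLex.degree p :=
      MonomialOrder.degLex.toSyn.injective (le_antisymm hge hle)
    rw [MonomialOrder.leadingCoeff, this]
    exact hpos.le
  · have hd := MonomialOrder.degLex.degree_add_of_lt h
    refine ⟨degLex_totalDegree_monotone (by rw [hd]), ?_⟩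
    rw [MonomialOrder.leadingCoeff_add_of_lt h]
    exact hp

lemma leadingCoeff_nonneg_of_isSumSq {s : MvPolynomial (Fin n) ℝ} (hs : IsSumSq s) :
    0 ≤ MonomialOrder.degLex.leadingCoeff s := by
  induction hs with
  | zero => simp
  | sq_add a _ ih =>
    refine (totalDegree_le_totalDegree_add ?_ ih).2
    rw [MonomialOrder.leadingCoeff_mul]
    exact mul_self_nonneg _

/-- Leading terms do not cancel in a sum of squares. -/
lemma totalDegree_le_of_sq_add {a s : MvPolynomial (Fin n) ℝ} (hs : IsSumSq s) {r : ℕ}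
    (h : (a * a + s).totalDegree ≤ 2 * r) : a.totalDegree ≤ r ∧ s.totalDegree ≤ 2 * r := by
  have ha := leadingCoeff_nonneg_of_isSumSq (IsSumSq.mul_self a)
  have hs' := leadingCoeff_nonneg_of_isSumSq hs
  have h1 := (totalDegree_le_totalDegree_add ha hs').1.trans h
  have h2 := (totalDegree_le_totalDegree_add hs' ha).1
  rw [add_comm s] at h2
  replace h2 := h2.trans h
  refine ⟨?_, h2⟩
  by_cases h0 : a = 0
  · simp [h0]
  · rw [totalDegree_mul_of_isDomain h0 h0] at h1
    omega

lemma mvPolynomial_eval_nonneg_of_isSumSq {s : MvPolynomial (Fin n) ℝ} (hs : IsSumSq s) (x : Fin n → ℝ) :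
    0 ≤ eval x s := by
  induction hs with
  | zero => simp
  | sq_add a _ ih => simpa using add_nonneg (mul_self_nonneg (eval x a)) ih

/-- Evaluation of polynomials at the points of a finite set. -/
noncomputable def evalOn (G : Finset (Fin n → ℝ)) : MvPolynomial (Fin n) ℝ →ₗ[ℝ] (G → ℝ) :=
  LinearMap.pi fun x ↦ (MvPolynomial.aeval (x : Fin n → ℝ)).toLinearMap

@[simp] lemma evalOn_apply (G : Finset (Fin n → ℝ)) (p : MvPolynomial (Fin n) ℝ) (x : G) :
    evalOn G p x = eval (x : Fin n → ℝ) p := by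
  simp [evalOn, MvPolynomial.aeval_eq_eval]

lemma evalOn_mul (G : Finset (Fin n → ℝ)) (p q : MvPolynomial (Fin n) ℝ) :
    evalOn G (p * q) = evalOn G p * evalOn G q := by
  ext x; simp

/-- The value vectors of the polynomials of degree at most `r`. -/
noncomputable def degreeValues (G : Finset (Fin n → ℝ)) (r : ℕ) : Submodule ℝ (G → ℝ) :=
  (restrictTotalDegree (Fin n) ℝ r).map (evalOn G)

lemma mem_degreeValues {G : Finset (Fin n → ℝ)} {r : ℕ} {v : G → ℝ} :
    v ∈ degreeValues G r ↔ ∃ p : MvPolynomial (Fin n) ℝ, p.totalDegree ≤ r ∧ evalOn G p = v := by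
  simp [degreeValues, Submodule.mem_map, mem_restrictTotalDegree]

/-- The value vectors of the sums of squares of degree at most `2 * r`. -/
def sosValues (G : Finset (Fin n → ℝ)) (r : ℕ) : Set (G → ℝ) :=
  {v | ∃ s : MvPolynomial (Fin n) ℝ, IsSumSq s ∧ s.totalDegree ≤ 2 * r ∧ evalOn G s = v}

/-- The squares of the value vectors of Euclidean norm one. -/
def unitSquares (G : Finset (Fin n → ℝ)) (r : ℕ) : Set (G → ℝ) :=
  (fun w ↦ w * w) '' {w | w ∈ degreeValues G r ∧ ∑ x, w x * w x = 1}

lemma isCompact_unitSquares (G : Finset (Fin n → ℝ)) (r : ℕ) : IsCompact (unitSquares G r) := by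
  refine IsCompact.image ?_ (by fun_prop)
  have hc : IsClosed {w : G → ℝ | w ∈ degreeValues G r ∧ ∑ x, w x * w x = 1} :=
    (degreeValues G r).closed_of_finiteDimensional.inter
      (isClosed_eq (by fun_prop) continuous_const)
  refine (isCompact_univ_pi fun _ : G ↦ isCompact_Icc (a := (-1 : ℝ)) (b := 1)).of_isClosed_subset
    hc ?_
  rintro w ⟨-, hw⟩ x -
  have := Finset.single_le_sum (f := fun x ↦ w x * w x) (fun x _ ↦ mul_self_nonneg (w x))
    (Finset.mem_univ x)
  rw [hw] at this
  exact abs_le.1 (abs_le_one_iff_mul_self_le_one.2 this)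

lemma zero_mem_sosValues (G : Finset (Fin n → ℝ)) (r : ℕ) : 0 ∈ sosValues G r :=
  ⟨0, .zero, by simp, by simp⟩

lemma smul_mem_sosValues {G : Finset (Fin n → ℝ)} {r : ℕ} {v : G → ℝ} (hv : v ∈ sosValues G r)
    {t : ℝ} (ht : 0 ≤ t) : t • v ∈ sosValues G r := by
  obtain ⟨s, hs, hd, rfl⟩ := hv
  refine ⟨t • s, ?_, (totalDegree_smul_le t s).trans hd, by simp⟩
  have : t • s = (C √t * C √t) * s := by rw [← C_mul, Real.mul_self_sqrt ht, smul_eq_C_mul]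
  rw [this]
  exact (IsSumSq.mul_self _).mul hs

lemma convex_sosValues (G : Finset (Fin n → ℝ)) (r : ℕ) : Convex ℝ (sosValues G r) := by
  intro v hv w hw s t hs ht _
  obtain ⟨p, hp, hpd, hpv⟩ := smul_mem_sosValues hv hs
  obtain ⟨q, hq, hqd, hqv⟩ := smul_mem_sosValues hw ht
  exact ⟨p + q, hp.add hq, (totalDegree_add _ _).trans (max_le hpd hqd), by rw [map_add, hpv, hqv]⟩

lemma convexHull_unitSquares_subset (G : Finset (Fin n → ℝ)) (r : ℕ) :
    convexHull ℝ (insert 0 (unitSquares G r)) ⊆ sosValues G r := by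
  refine convexHull_min (Set.insert_subset (zero_mem_sosValues G r) ?_) (convex_sosValues G r)
  rintro _ ⟨w, ⟨hw, -⟩, rfl⟩
  obtain ⟨p, hp, rfl⟩ := mem_degreeValues.1 hw
  refine ⟨p * p, .mul_self p, ?_, evalOn_mul G p p⟩
  have := totalDegree_mul p p
  omega

-- Each square is normalised by the sum of its values on `G`, and the pieces add up through `(s + t)
-- • K = s • K + t • K` for convex `K` and nonnegative `s`, `t`. Thus the cone of value vectors has
-- a compact base, with a scaling factor that is read off from the vector itself.
open scoped Pointwise in
lemma evalOn_mem_smul {G : Finset (Fin n → ℝ)} {r : ℕ} {s : MvPolynomial (Fin n) ℝ}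
    (hs : IsSumSq s) (hd : s.totalDegree ≤ 2 * r) :
    evalOn G s ∈ (∑ x, evalOn G s x) • convexHull ℝ (insert 0 (unitSquares G r)) := by
  set K := convexHull ℝ (insert 0 (unitSquares G r)) with hK
  have h0 : (0 : G → ℝ) ∈ K := subset_convexHull ℝ _ (Set.mem_insert _ _)
  induction hs with
  | zero => exact ⟨0, h0, by simp⟩
  | @sq_add a s hs ih =>
    obtain ⟨had, hsd⟩ := totalDegree_le_of_sq_add hs hd
    have hpos : 0 ≤ ∑ x, evalOn G (a * a) x :=
      Finset.sum_nonneg fun x _ ↦ by simpa using mul_self_nonneg _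
    have hpos' : 0 ≤ ∑ x, evalOn G s x :=
      Finset.sum_nonneg fun x _ ↦ by simpa using mvPolynomial_eval_nonneg_of_isSumSq hs _
    have key : evalOn G (a * a) ∈ (∑ x, evalOn G (a * a) x) • K := by
      set c := ∑ x, evalOn G (a * a) x with hc
      rcases hpos.eq_or_lt with h | h
      · have hz : ∀ x, evalOn G (a * a) x = 0 := fun x ↦
          (Finset.sum_eq_zero_iff_of_nonneg (fun x _ ↦ by simpa using mul_self_nonneg _)).1
            (hc.symm.trans h.symm) x (Finset.mem_univ x)
        exact ⟨0, h0, by ext x; simp [hz, -evalOn_apply]⟩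
      · have hsq : √c * √c = c := Real.mul_self_sqrt h.le
        have hsc : √c ≠ 0 := (Real.sqrt_pos.2 h).ne'
        have hw : ((√c)⁻¹ • evalOn G a) * ((√c)⁻¹ • evalOn G a) = c⁻¹ • evalOn G (a * a) := by
          rw [evalOn_mul, smul_mul_smul_comm, ← mul_inv, hsq]
        refine ⟨_, subset_convexHull ℝ _ (.inr ⟨(√c)⁻¹ • evalOn G a, ⟨?_, ?_⟩, rfl⟩), ?_⟩
        · exact Submodule.smul_mem _ _ (mem_degreeValues.2 ⟨a, had, rfl⟩)
        · have : ∀ x, ((√c)⁻¹ • evalOn G a) x * ((√c)⁻¹ • evalOn G a) x =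
              c⁻¹ * evalOn G (a * a) x := fun x ↦ congrFun hw x
          rw [Finset.sum_congr rfl fun x _ ↦ this x, ← Finset.mul_sum, ← hc, inv_mul_cancel₀ h.ne']
        · simp only [hw, smul_smul, mul_inv_cancel₀ h.ne', one_smul]
    have hsum : ∑ x, evalOn G (a * a + s) x = ∑ x, evalOn G (a * a) x + ∑ x, evalOn G s x := by
      rw [← Finset.sum_add_distrib, map_add]; rfl
    rw [hsum, (convex_convexHull ℝ _).add_smul hpos hpos', map_add]
    exact Set.add_mem_add key (ih hsd)

/-- The value vectors of sums of squares of bounded degree form a closed cone. -/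
theorem isClosed_sosValues (G : Finset (Fin n → ℝ)) (r : ℕ) : IsClosed (sosValues G r) := by
  have hK : IsCompact (convexHull ℝ (insert 0 (unitSquares G r))) :=
    isCompact_convexHull ((isCompact_unitSquares G r).insert 0)
  refine IsSeqClosed.isClosed fun v v' hv hlim ↦ ?_
  -- The scaling factors converge with `v k`, so only the `u k` need a convergent subsequence.
  have : ∀ k, ∃ u ∈ convexHull ℝ (insert 0 (unitSquares G r)), (∑ x, v k x) • u = v k := by
    intro k
    obtain ⟨s, hs, hd, hsv⟩ := hv k
    rw [← hsv]
    exact evalOn_mem_smul hs hd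
  choose u hu huv using this
  obtain ⟨u', hu', φ, hφ, hφlim⟩ := hK.tendsto_subseq hu
  have ht : Tendsto (fun k ↦ ∑ x, v k x) atTop (𝓝 (∑ x, v' x)) :=
    tendsto_finsetSum _ fun x _ ↦ (tendsto_pi_nhds.1 hlim) x
  have h1 : Tendsto (fun k ↦ v (φ k)) atTop (𝓝 ((∑ x, v' x) • u')) := by
    refine ((ht.comp hφ.tendsto_atTop).smul hφlim).congr fun k ↦ ?_
    exact huv (φ k)
  rw [tendsto_nhds_unique (hlim.comp hφ.tendsto_atTop) h1]
  refine smul_mem_sosValues (convexHull_unitSquares_subset G r hu') ?_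
  refine ge_of_tendsto' ht fun k ↦ Finset.sum_nonneg fun x _ ↦ ?_
  obtain ⟨s, hs, -, hsv⟩ := hv k
  rw [← hsv, evalOn_apply]
  exact mvPolynomial_eval_nonneg_of_isSumSq hs _

/-- Every nonempty open set contains a finite set on which no nonzero polynomial of degree at
most `d` vanishes. -/
lemma exists_finset_unisolvent {O : Set (Fin n → ℝ)} (hO : IsOpen O) (hne : O.Nonempty) (d : ℕ) :
    ∃ G : Finset (Fin n → ℝ), (∀ x ∈ G, x ∈ O) ∧
      ∀ p : MvPolynomial (Fin n) ℝ, p.totalDegree ≤ d → (∀ x ∈ G, eval x p = 0) → p = 0 := by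
  obtain ⟨z, hz⟩ := hne
  obtain ⟨δ, hδ, hball⟩ := Metric.isOpen_iff.1 hO z hz
  have hS : ∀ i, ∃ S : Finset ℝ, (S : Set ℝ) ⊆ Metric.ball (z i) δ ∧ S.card = d + 1 := fun i ↦ by
    have : (Metric.ball (z i) δ).Infinite := by
      rw [Real.ball_eq_Ioo]
      exact Set.Ioo_infinite (by linarith)
    exact this.exists_subset_card_eq (d + 1)
  choose S hSb hSc using hS
  refine ⟨Fintype.piFinset S, fun x hx ↦ hball ?_, fun p hp hev ↦ ?_⟩
  · rw [Metric.mem_ball, dist_pi_lt_iff hδ]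
    exact fun i ↦ hSb i (Fintype.mem_piFinset.1 hx i)
  · refine eq_zero_of_eval_zero_at_prod_finset p S (fun i ↦ ?_)
      fun x hx ↦ hev x (Fintype.mem_piFinset.2 hx)
    rw [hSc]
    exact Nat.lt_succ_of_le ((degreeOf_le_totalDegree p i).trans hp)

/-- The quadratic module generated by `g`, truncated at degree `2 * r`. -/
def truncatedModule {ι : Type*} [Fintype ι] (g : ι → MvPolynomial (Fin n) ℝ) (r : ℕ) :
    Set (MvPolynomial (Fin n) ℝ) :=
  {p | ∃ s : ι → MvPolynomial (Fin n) ℝ, (∀ j, IsSumSq (s j)) ∧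
    (∀ j, (s j * g j).totalDegree ≤ 2 * r) ∧ p = ∑ j, s j * g j}

/-- Membership in the truncated quadratic module of a set with an interior point is a closed
condition. -/
theorem isClosed_setOf_mem_truncatedModule {ι : Type*} [Fintype ι]
    (g : ι → MvPolynomial (Fin n) ℝ) (hg : ∃ x, ∀ j, 0 < eval x (g j)) (r : ℕ)
    {Y : Type*} [TopologicalSpace Y] (T : Y → MvPolynomial (Fin n) ℝ)
    (hT : ∀ x, Continuous fun y ↦ eval x (T y)) (hdeg : ∀ y, (T y).totalDegree ≤ 2 * r) :
    IsClosed {y | T y ∈ truncatedModule g r} := by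
  have hO : IsOpen {x : Fin n → ℝ | ∀ j, 0 < eval x (g j)} := by
    simp only [Set.ofPred_forall]
    exact isOpen_iInter_of_finite fun j ↦
      isOpen_lt continuous_const (MvPolynomial.continuous_eval (g j))
  obtain ⟨z, hz⟩ := hg
  have hg0 : ∀ j, g j ≠ 0 := fun j h0 ↦ by simpa [h0] using hz j
  -- The degree is large enough to identify `s * g j` from its values on `G` when only `s` is known
  -- to have degree at most `2 * r`.
  obtain ⟨G, hGO, hG⟩ := exists_finset_unisolvent hO ⟨z, hz⟩ (2 * r + ∑ j, (g j).totalDegree)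
  have hinj : ∀ p q : MvPolynomial (Fin n) ℝ, p.totalDegree ≤ 2 * r + ∑ j, (g j).totalDegree →
      q.totalDegree ≤ 2 * r + ∑ j, (g j).totalDegree → evalOn G p = evalOn G q → p = q := by
    intro p q hp hq h
    refine sub_eq_zero.1 (hG _ ((totalDegree_sub _ _).trans (max_le hp hq)) fun x hx ↦ ?_)
    have := congrFun h ⟨x, hx⟩
    simpa [sub_eq_zero] using this
  -- The bound on the degree of `s * g j` becomes a linear condition on values; unisolvence of `G`
  -- turns it back into a degree bound in `hDspec`.
  set D : ι → Set (G → ℝ) := fun j ↦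
    {v | v ∈ sosValues G r ∧ v * evalOn G (g j) ∈ degreeValues G (2 * r)} with hDdef
  have hDclosed : ∀ j, IsClosed (D j) := fun j ↦ (isClosed_sosValues G r).inter
    ((degreeValues G (2 * r)).closed_of_finiteDimensional.preimage (by fun_prop))
  have hDspec : ∀ j v, v ∈ D j → ∃ s, IsSumSq s ∧ (s * g j).totalDegree ≤ 2 * r ∧
      evalOn G s = v := by
    rintro j _ ⟨⟨s, hs, hsd, rfl⟩, hd⟩
    obtain ⟨q, hq, hqv⟩ := mem_degreeValues.1 hd
    refine ⟨s, hs, ?_, rfl⟩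
    have hle : (g j).totalDegree ≤ ∑ j, (g j).totalDegree :=
      Finset.single_le_sum (f := fun j ↦ (g j).totalDegree) (fun _ _ ↦ Nat.zero_le _)
        (Finset.mem_univ j)
    have := totalDegree_mul s (g j)
    rw [← hinj q (s * g j) (by omega) (by omega) (by rw [hqv, evalOn_mul])]
    exact hq
  have hspecD : ∀ j s, IsSumSq s → (s * g j).totalDegree ≤ 2 * r → evalOn G s ∈ D j := by
    refine fun j s hs hd ↦ ⟨⟨s, hs, ?_, rfl⟩, mem_degreeValues.2 ⟨_, hd, evalOn_mul G _ _⟩⟩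
    by_cases h0 : s = 0
    · simp [h0]
    · rw [totalDegree_mul_of_isDomain h0 (hg0 j)] at hd
      omega
  set Q : Set (G → ℝ) := {v | ∃ w : ι → G → ℝ, (∀ j, w j ∈ D j) ∧ v = ∑ j, w j * evalOn G (g j)}
  have hgpos : ∀ (j : ι) (x : G), 0 < evalOn G (g j) x := fun j x ↦ by
    rw [evalOn_apply]; exact hGO x x.2 j
  have hQ : IsClosed Q := by
    refine IsSeqClosed.isClosed fun v v' hv hlim ↦ ?_
    choose w hw hwv using hv
    have hbdd : ∀ x, ∃ M, ∀ k, v k x ≤ M := fun x ↦ by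
      obtain ⟨M, hM⟩ := ((tendsto_pi_nhds.1 hlim) x).bddAbove_range
      exact ⟨M, fun k ↦ hM ⟨k, rfl⟩⟩
    choose M hM using hbdd
    have hwnn : ∀ k j x, 0 ≤ w k j x := fun k j x ↦ by
      obtain ⟨s, hs, -, hsv⟩ := hDspec j _ (hw k j)
      rw [← hsv, evalOn_apply]
      exact mvPolynomial_eval_nonneg_of_isSumSq hs _
    -- All summands are nonnegative on `G`, so none exceeds the bounded total; strict positivity of
    -- `g j` there then bounds the multipliers.
    have hbox : ∀ k, w k ∈ Set.univ.pi fun j ↦ Set.univ.pi fun x ↦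
        Set.Icc 0 (M x / evalOn G (g j) x) := fun k j _ x _ ↦ by
      refine ⟨hwnn k j x, (le_div_iff₀ (hgpos j x)).2 (le_trans ?_ (hM x k))⟩
      rw [hwv k, Finset.sum_apply]
      exact Finset.single_le_sum (f := fun j ↦ (w k j * evalOn G (g j)) x)
        (fun j _ ↦ mul_nonneg (hwnn k j x) (hgpos j x).le) (Finset.mem_univ j)
    obtain ⟨w', -, φ, hφ, hφlim⟩ := (isCompact_univ_pi fun j : ι ↦ isCompact_univ_pi fun x : G ↦
      isCompact_Icc (a := (0 : ℝ)) (b := M x / evalOn G (g j) x)).tendsto_subseq hbox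
    have hj : ∀ j, Tendsto (fun k ↦ w (φ k) j) atTop (𝓝 (w' j)) := fun j ↦
      (tendsto_pi_nhds.1 hφlim) j
    refine ⟨w', fun j ↦ (hDclosed j).mem_of_tendsto (hj j) (.of_forall fun k ↦ hw (φ k) j), ?_⟩
    refine tendsto_nhds_unique (hlim.comp hφ.tendsto_atTop) ?_
    refine (tendsto_finsetSum Finset.univ fun j _ ↦ (hj j).mul_const (evalOn G (g j))).congr
      fun k ↦ (hwv (φ k)).symm
  have hset : {y | T y ∈ truncatedModule g r} = (fun y ↦ evalOn G (T y)) ⁻¹' Q := by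
    ext y
    constructor
    · rintro ⟨s, hs, hsd, hsum⟩
      refine ⟨fun j ↦ evalOn G (s j), fun j ↦ hspecD j _ (hs j) (hsd j), ?_⟩
      simp only [hsum, map_sum, evalOn_mul]
    · rintro ⟨w, hw, hwv⟩
      choose s hs hsd hsw using fun j ↦ hDspec j _ (hw j)
      refine ⟨s, hs, hsd, hinj _ _ ((hdeg y).trans (Nat.le_add_right _ _)) ?_ ?_⟩
      · exact (totalDegree_finsetSum_le fun j _ ↦ hsd j).trans (Nat.le_add_right _ _)
      · simp only [map_sum, evalOn_mul, hsw]
        exact hwv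
  rw [hset]
  exact hQ.preimage (continuous_pi fun x ↦ by simpa using hT x)

end TruncatedModule

/-! ### Duality for worst-case expectations over a Wasserstein ball. -/

section Duality

lemma isProbabilityMeasure_empirical {X : Type*} [MeasurableSpace X] {N : ℕ} (hN : 0 < N)
    (x : Fin N → X) : IsProbabilityMeasure (empirical x) := by
  constructor
  simp only [empirical, Measure.smul_apply, Measure.finsetSum_apply, measure_univ,
    Finset.sum_const, Finset.card_univ, Fintype.card_fin, smul_eq_mul, nsmul_eq_mul, mul_one]
  exact ENNReal.inv_mul_cancel (by simpa using hN.ne') (by simp)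

variable {X : Type*} [MetricSpace X] [CompactSpace X] [MeasurableSpace X] [BorelSpace X]

lemma integrable_of_continuous {Y : Type*} [TopologicalSpace Y] [CompactSpace Y]
    [MeasurableSpace Y] [OpensMeasurableSpace Y] {μ : Measure Y} [IsFiniteMeasure μ] {g : Y → ℝ}
    (hg : Continuous g) : Integrable g μ :=
  hg.integrable_of_hasCompactSupport (HasCompactSupport.of_compactSpace g)

lemma integral_empirical {N : ℕ} (x : Fin N → X) {g : X → ℝ} (hg : Continuous g) :
    ∫ y, g y ∂(empirical x) = (1 / (N : ℝ)) * ∑ i, g (x i) := by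
  rw [empirical, integral_smul_measure,
    integral_finsetSum_measure fun i _ ↦ integrable_of_continuous hg]
  simp

lemma lintegral_edist_sq {π : Measure (X × X)} [IsFiniteMeasure π] :
    ∫⁻ p, edist p.1 p.2 ^ 2 ∂π = ENNReal.ofReal (∫ p, dist p.1 p.2 ^ 2 ∂π) := by
  rw [ofReal_integral_eq_lintegral_ofReal (integrable_of_continuous (by fun_prop))
    (.of_forall fun p ↦ by positivity)]
  refine lintegral_congr fun p ↦ ?_
  rw [edist_dist, ENNReal.ofReal_pow dist_nonneg]

lemma isProbabilityMeasure_of_map {α β : Type*} [MeasurableSpace α] [MeasurableSpace β]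
    {π : Measure α} {φ : α → β} (hφ : Measurable φ) [h : IsProbabilityMeasure (π.map φ)] :
    IsProbabilityMeasure π := by
  constructor
  have := h.measure_univ
  rwa [Measure.map_apply hφ .univ, Set.preimage_univ] at this

/-- Weak duality for worst-case expectations over a Wasserstein ball. -/
theorem integral_le_dual {N : ℕ} (hN : 0 < N) {f : X → ℝ} (hf : Continuous f)
    {ε : ℝ} (hε : 0 < ε) (x₀ : Fin N → X) {Q : Measure X}
    (hQ : Q ∈ wassersteinBall (empirical x₀) ε) {lam : ℝ} (hlam : 0 ≤ lam) {α : Fin N → ℝ}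
    (hα : ∀ i x, f x ≤ lam * dist x (x₀ i) ^ 2 - α i) :
    ∫ x, f x ∂Q ≤ lam * ε ^ 2 - (1 / (N : ℝ)) * ∑ i, α i := by
  obtain ⟨hQp, hQd⟩ := hQ
  have : Nonempty X := ⟨x₀ ⟨0, hN⟩⟩
  -- This transform of `f` extends the bounds `-α i` from the data points to a continuous function
  -- on all of `X`, which can be integrated against the second marginal.
  set A : X → ℝ := fun y ↦ sSup ((fun x ↦ f x - lam * dist x y ^ 2) '' Set.univ) with hA
  have hAc : Continuous A := isCompact_univ.continuous_sSup (by fun_prop)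
  have hle : ∀ x y, f x ≤ lam * dist x y ^ 2 + A y := fun x y ↦ by
    have : f x - lam * dist x y ^ 2 ≤ A y :=
      le_csSup (isCompact_univ.image (by fun_prop)).bddAbove ⟨x, trivial, rfl⟩
    linarith
  have hAα : ∀ i, A (x₀ i) ≤ -α i := fun i ↦ by
    refine csSup_le (Set.univ_nonempty.image _) ?_
    rintro _ ⟨x, -, rfl⟩
    linarith [hα i x]
  -- The slack `δ` provides a nearly optimal coupling, so attainment of the infimum defining the
  -- distance is not needed.
  have key : ∀ δ > 0, ∫ x, f x ∂Q ≤ lam * (ε + δ) ^ 2 - (1 / (N : ℝ)) * ∑ i, α i := by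
    intro δ hδ
    have hlt : wassersteinDist Q (empirical x₀) < ENNReal.ofReal (ε + δ) :=
      hQd.trans_lt ((ENNReal.ofReal_lt_ofReal_iff (by positivity)).2 (by linarith))
    rw [wassersteinDist] at hlt
    simp only [iInf_lt_iff] at hlt
    obtain ⟨π, ⟨h1, h2⟩, hπ⟩ := hlt
    have hπp : IsProbabilityMeasure π := by
      rw [← h1] at hQp
      exact isProbabilityMeasure_of_map measurable_fst
    have hcost : ∫ p, dist p.1 p.2 ^ 2 ∂π ≤ (ε + δ) ^ 2 := by
      rw [lintegral_edist_sq, one_div, ENNReal.rpow_inv_lt_iff (by norm_num)] at hπ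
      rw [ENNReal.ofReal_rpow_of_nonneg (by positivity) (by norm_num)] at hπ
      have := (ENNReal.ofReal_lt_ofReal_iff'.1 hπ).1.le
      simpa using this
    calc ∫ x, f x ∂Q = ∫ p, f p.1 ∂π := by
          rw [← h1, integral_map (by fun_prop) hf.aestronglyMeasurable]
      _ ≤ ∫ p, (lam * dist p.1 p.2 ^ 2 + A p.2) ∂π :=
          integral_mono (integrable_of_continuous (by fun_prop))
            (integrable_of_continuous (by fun_prop)) fun p ↦ hle p.1 p.2
      _ = lam * ∫ p, dist p.1 p.2 ^ 2 ∂π + ∫ y, A y ∂(empirical x₀) := by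
          rw [integral_add (integrable_of_continuous (by fun_prop))
            (integrable_of_continuous (by fun_prop)), integral_const_mul, ← h2,
            integral_map (by fun_prop) hAc.aestronglyMeasurable]
      _ ≤ lam * (ε + δ) ^ 2 - (1 / (N : ℝ)) * ∑ i, α i := by
          rw [integral_empirical _ hAc, sub_eq_add_neg, ← mul_neg, ← Finset.sum_neg_distrib]
          gcongr with i
          exact hAα i
  have hlim : Tendsto (fun δ : ℝ ↦ lam * (ε + δ) ^ 2 - (1 / (N : ℝ)) * ∑ i, α i) (𝓝[>] 0)
      (𝓝 (lam * (ε + 0) ^ 2 - (1 / (N : ℝ)) * ∑ i, α i)) :=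
    (Continuous.tendsto (by fun_prop) 0).mono_left nhdsWithin_le_nhds
  rw [add_zero] at hlim
  exact ge_of_tendsto hlim (eventually_nhdsWithin_of_forall key)

/-- The pairs (transport cost, expected value) of the couplings with second marginal `P`. -/
def couplingValues (P : Measure X) (f : X → ℝ) : Set (ℝ × ℝ) :=
  {p | ∃ π : Measure (X × X), IsProbabilityMeasure π ∧ π.map Prod.snd = P ∧
    ∫ z, dist z.1 z.2 ^ 2 ∂π = p.1 ∧ ∫ z, f z.1 ∂π = p.2}

lemma convex_couplingValues (P : Measure X) {f : X → ℝ} (hf : Continuous f) :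
    Convex ℝ (couplingValues P f) := by
  rintro ⟨c, v⟩ ⟨π, hπ, hπP, hc, hv⟩ ⟨c', v'⟩ ⟨ρ, hρ, hρP, hc', hv'⟩ s t hs ht hst
  dsimp only at hc hv hc' hv'
  have hst' : ENNReal.ofReal s + ENNReal.ofReal t = 1 := by
    rw [← ENNReal.ofReal_add hs ht, hst, ENNReal.ofReal_one]
  have hI : ∀ g : X × X → ℝ, Continuous g →
      ∫ z, g z ∂(ENNReal.ofReal s • π + ENNReal.ofReal t • ρ) =
        s * ∫ z, g z ∂π + t * ∫ z, g z ∂ρ := fun g hg ↦ by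
    rw [integral_add_measure
      ((integrable_of_continuous hg).smul_measure ENNReal.ofReal_ne_top)
      ((integrable_of_continuous hg).smul_measure ENNReal.ofReal_ne_top),
      integral_smul_measure, integral_smul_measure, ENNReal.toReal_ofReal hs,
      ENNReal.toReal_ofReal ht, smul_eq_mul, smul_eq_mul]
  refine ⟨ENNReal.ofReal s • π + ENNReal.ofReal t • ρ, ⟨by simp [hst']⟩, ?_, ?_, ?_⟩
  · rw [Measure.map_add _ _ measurable_snd, Measure.map_smul, Measure.map_smul, hπP, hρP,
      ← add_smul, hst', one_smul]
  · rw [hI _ (by fun_prop), hc, hc']; simp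
  · rw [hI _ (by fun_prop), hv, hv']; simp

/-- Cost and value of moving the data points `x₀ i` to `x i`. -/
noncomputable def transportPoint {N : ℕ} (x₀ : Fin N → X) (f : X → ℝ) (x : Fin N → X) : ℝ × ℝ :=
  ((1 / (N : ℝ)) * ∑ i, dist (x i) (x₀ i) ^ 2, (1 / (N : ℝ)) * ∑ i, f (x i))

lemma transportPoint_mem {N : ℕ} (hN : 0 < N) (x₀ : Fin N → X) {f : X → ℝ} (hf : Continuous f)
    (x : Fin N → X) : transportPoint x₀ f x ∈ couplingValues (empirical x₀) f := by
  refine ⟨empirical fun i ↦ (x i, x₀ i), isProbabilityMeasure_empirical hN _, ?_, ?_, ?_⟩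
  · rw [empirical, Measure.map_smul, ← Measure.mapₗ_apply_of_measurable measurable_snd, map_sum]
    simp_rw [Measure.mapₗ_apply_of_measurable measurable_snd, Measure.map_dirac' measurable_snd]
    rfl
  · rw [integral_empirical _ (by fun_prop)]; rfl
  · rw [integral_empirical _ (by fun_prop)]; rfl

lemma mem_wassersteinBall_of_coupling {P : Measure X} {ε : ℝ} (hε : 0 ≤ ε) {π : Measure (X × X)}
    [IsProbabilityMeasure π] (hπ : π.map Prod.snd = P)
    (hc : ∫ z, dist z.1 z.2 ^ 2 ∂π ≤ ε ^ 2) : π.map Prod.fst ∈ wassersteinBall P ε := by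
  refine ⟨Measure.isProbabilityMeasure_map (by fun_prop), iInf₂_le_of_le π ⟨rfl, hπ⟩ ?_⟩
  rw [lintegral_edist_sq, one_div, ENNReal.rpow_inv_le_iff (by norm_num),
    ENNReal.ofReal_rpow_of_nonneg hε (by norm_num)]
  refine ENNReal.ofReal_le_ofReal ?_
  simpa using hc

/-- Letting `t → ∞` controls the slope and `t → 0` the intercept; this extracts the signs of a
functional bounded on an open quadrant. -/
lemma slope_nonpos_of_forall_lt {A B u : ℝ} (h : ∀ t > 0, A + B * t < u) : B ≤ 0 ∧ A ≤ u := by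
  constructor
  · by_contra! hB
    have := h ((|u - A| + 1) / B) (by positivity)
    rw [mul_div_cancel₀ _ hB.ne'] at this
    linarith [le_abs_self (u - A)]
  · have hlim : Tendsto (fun t : ℝ ↦ A + B * t) (𝓝[>] 0) (𝓝 (A + B * 0)) :=
      (Continuous.tendsto (by fun_prop) 0).mono_left nhdsWithin_le_nhds
    rw [mul_zero, add_zero] at hlim
    exact le_of_tendsto hlim (eventually_nhdsWithin_of_forall fun t ht ↦ (h t ht).le)

/-- Lagrange multiplier rule for a planar convex set: the maximal height under a bound on the
abscissa is certified by a nonnegative multiplier. -/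
lemma exists_multiplier {S : Set (ℝ × ℝ)} (hS : Convex ℝ S) {e v : ℝ} (he : 0 < e)
    (hmax : ∀ p ∈ S, p.1 ≤ e → p.2 ≤ v) (hslater : ∃ w, ((0 : ℝ), w) ∈ S) :
    ∃ lam, 0 ≤ lam ∧ ∀ p ∈ S, lam * e + (p.2 - lam * p.1) ≤ v := by
  obtain ⟨w, hw⟩ := hslater
  have hconv : Convex ℝ (Set.Iio e ×ˢ Set.Ioi v) := (convex_Iio e).prod (convex_Ioi v)
  have hdisj : Disjoint (Set.Iio e ×ˢ Set.Ioi v) S := by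
    rw [Set.disjoint_left]
    rintro p ⟨h1, h2⟩ hp
    exact absurd (hmax p hp (le_of_lt h1)) (not_le.2 h2)
  -- The open quadrant holds the points that are cheaper than `e` and better than `v`; maximality
  -- makes it disjoint from `S`.
  obtain ⟨φ, u, hlt, hge⟩ := geometric_hahn_banach_open hconv (isOpen_Iio.prod isOpen_Ioi) hS hdisj
  set p := φ (1, 0)
  set q := φ (0, 1)
  have hφ : ∀ x y, φ (x, y) = p * x + q * y := fun x y ↦ by
    have : ((x, y) : ℝ × ℝ) = x • ((1 : ℝ), (0 : ℝ)) + y • ((0 : ℝ), (1 : ℝ)) := by simp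
    rw [this, map_add, map_smul, map_smul, smul_eq_mul, smul_eq_mul, mul_comm x, mul_comm y]
  have hlt' : ∀ s > 0, ∀ t > 0, p * (e - s) + q * (v + t) < u := fun s hs t ht ↦ by
    rw [← hφ]
    exact hlt _ ⟨by simpa using hs, by simpa using ht⟩
  have hq : q ≤ 0 := (slope_nonpos_of_forall_lt (A := p * (e - 1) + q * v) (u := u)
    fun t ht ↦ by linarith [hlt' 1 one_pos t ht]).1
  have hp : -p ≤ 0 := (slope_nonpos_of_forall_lt (A := p * e + q * (v + 1)) (u := u)
    fun s hs ↦ by linarith [hlt' s hs 1 one_pos]).1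
  have hu : p * e + q * v ≤ u := (slope_nonpos_of_forall_lt (B := q - p)
    fun s hs ↦ by linarith [hlt' s hs s hs]).2
  have hw' : u ≤ q * w := by simpa [hφ] using hge _ hw
  -- A vertical separating line (`q = 0`) is excluded by the point of cost `0 < e`, so the
  -- multiplier can be normalised by `-q`.
  have hq0 : 0 < -q := by
    refine neg_pos.2 (lt_of_le_of_ne hq fun h0 ↦ ?_)
    have h1 := hlt' (e / 2) (half_pos he) 1 one_pos
    rw [h0] at h1 hw'
    have h2 : 0 ≤ p * (e - e / 2) := mul_nonneg (by linarith) (by linarith)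
    linarith
  refine ⟨p / -q, div_nonneg (by linarith) hq0.le, fun b hb ↦ ?_⟩
  have hb' : u ≤ p * b.1 + q * b.2 := by rw [← hφ]; exact hge _ hb
  have h1 : p / -q * (e - b.1) ≤ v - b.2 := by
    rw [div_mul_eq_mul_div, div_le_iff₀ hq0]
    linarith
  linarith

/-- Strong duality for worst-case expectations over a Wasserstein ball around an empirical
distribution. -/
theorem exists_worstCase_and_multiplier {N : ℕ} (hN : 0 < N) {f : X → ℝ} (hf : Continuous f)
    {ε : ℝ} (hε : 0 < ε) (x₀ : Fin N → X) :
    ∃ Q ∈ wassersteinBall (empirical x₀) ε, ∃ lam, 0 ≤ lam ∧ ∀ x : Fin N → X,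
      lam * ε ^ 2 + (1 / (N : ℝ)) * ∑ i, (f (x i) - lam * dist (x i) (x₀ i) ^ 2) ≤ ∫ y, f y ∂Q := by
  -- The hull lies in a plane, so its compactness yields an optimal coupling with no weak
  -- compactness of measures.
  set S := convexHull ℝ (Set.range (transportPoint x₀ f))
  have hScomp : IsCompact S := by
    refine isCompact_convexHull (isCompact_range ?_)
    unfold transportPoint
    fun_prop
  have hsub : S ⊆ couplingValues (empirical x₀) f :=
    convexHull_min (by rintro _ ⟨x, rfl⟩; exact transportPoint_mem hN x₀ hf x)
      (convex_couplingValues _ hf)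
  have hbase : ((0 : ℝ), (1 / (N : ℝ)) * ∑ i, f (x₀ i)) ∈ S :=
    subset_convexHull ℝ _ ⟨x₀, by simp [transportPoint]⟩
  obtain ⟨m, ⟨hmS, hme⟩, hmax⟩ := (hScomp.inter_right
    (isClosed_le continuous_fst continuous_const : IsClosed {p : ℝ × ℝ | p.1 ≤ ε ^ 2})).exists_isMaxOn
    ⟨_, hbase, by simpa using sq_nonneg ε⟩ continuous_snd.continuousOn
  obtain ⟨π, hπ, hπP, hc, hv⟩ := hsub hmS
  obtain ⟨lam, hlam, hle⟩ := exists_multiplier (convex_convexHull ℝ _ : Convex ℝ S)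
    (sq_pos_of_pos hε) (fun p hp hpe ↦ hmax ⟨hp, hpe⟩) ⟨_, hbase⟩
  refine ⟨π.map Prod.fst, mem_wassersteinBall_of_coupling hε.le hπP (hc.trans_le hme), lam, hlam,
    fun x ↦ ?_⟩
  rw [integral_map (by fun_prop) hf.aestronglyMeasurable, hv]
  refine le_trans (le_of_eq ?_) (hle _ (subset_convexHull ℝ _ ⟨x, rfl⟩))
  simp only [transportPoint, Finset.sum_sub_distrib, ← Finset.mul_sum]
  ring

end Duality

/-! ### Certificates in the lifted quadratic module. -/

section Certificates

open Polynomial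

lemma isSumSq_map {R S : Type*} [CommSemiring R] [CommSemiring S] (φ : R →+* S) {s : R}
    (hs : IsSumSq s) : IsSumSq (φ s) := by
  induction hs with
  | zero => rw [map_zero]; exact .zero
  | sq_add a _ ih => rw [map_add, map_mul]; exact .sq_add _ ih

/-- The quadratic module generated by `g`. -/
def quadraticModule {R ι : Type*} [CommRing R] [Fintype ι] (g : ι → R) : Set R :=
  {p | ∃ s : ι → R, (∀ j, IsSumSq (s j)) ∧ p = ∑ j, s j * g j}

lemma add_mem_quadraticModule {R ι : Type*} [CommRing R] [Fintype ι] {g : ι → R} {p q : R}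
    (hp : p ∈ quadraticModule g) (hq : q ∈ quadraticModule g) : p + q ∈ quadraticModule g := by
  obtain ⟨s, hs, rfl⟩ := hp
  obtain ⟨t, ht, rfl⟩ := hq
  exact ⟨s + t, fun j ↦ (hs j).add (ht j), by simp [add_mul, Finset.sum_add_distrib]⟩

lemma mul_mem_quadraticModule {R ι : Type*} [CommRing R] [Fintype ι] {g : ι → R} {p s : R}
    (hp : p ∈ quadraticModule g) (hs : IsSumSq s) : s * p ∈ quadraticModule g := by
  obtain ⟨t, ht, rfl⟩ := hp
  exact ⟨fun j ↦ s * t j, fun j ↦ hs.mul (ht j), by simp [Finset.mul_sum, mul_assoc]⟩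

lemma self_mem_quadraticModule {R ι : Type*} [CommRing R] [Fintype ι] (g : ι → R) (j : ι) :
    g j ∈ quadraticModule g := by
  classical
  refine ⟨Pi.single j 1, fun i ↦ ?_, by simp [Pi.single_apply]⟩
  by_cases h : i = j
  · subst h; rw [Pi.single_eq_same]; exact .one
  · rw [Pi.single_eq_of_ne h]; exact .zero

/-- Substituting `z` into a univariate certificate keeps squares as squares and sends the interval
constraints to elements of the module. -/
lemma aeval_mem_quadraticModule {S ι : Type*} [CommRing S] [Algebra ℝ S] [Fintype ι] {g : ι → S}
    (h1 : 1 ∈ quadraticModule g) {z : S} {A B : ℝ} (hA : z - algebraMap ℝ S A ∈ quadraticModule g)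
    (hB : algebraMap ℝ S B - z ∈ quadraticModule g) {u : ℝ[X]} (hu : u ∈ intervalModule A B) :
    aeval z u ∈ quadraticModule g := by
  obtain ⟨s₀, s₁, s₂, hs₀, hs₁, hs₂, rfl⟩ := hu
  have hsq : ∀ s : ℝ[X], IsSumSq s → IsSumSq (aeval z s) := fun s hs ↦
    isSumSq_map (aeval z : ℝ[X] →ₐ[ℝ] S).toRingHom hs
  have h := add_mem_quadraticModule (add_mem_quadraticModule
    (mul_mem_quadraticModule h1 (hsq _ hs₀)) (mul_mem_quadraticModule hA (hsq _ hs₁)))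
    (mul_mem_quadraticModule hB (hsq _ hs₂))
  simpa using h

/-- Weights `s₁ ^ 2`, `s₂ ^ 2` that nearly sum to one on `[A, B]` and almost recover the pointwise
maximum of `g₁` and `g₂`. -/
lemma exists_square_weights (A B : ℝ) (g₁ g₂ : ℝ[X]) {δ : ℝ} (hδ : 0 < δ) :
    ∃ s₁ s₂ : ℝ[X], ∀ x ∈ Set.Icc A B,
      |1 - s₁.eval x ^ 2 - s₂.eval x ^ 2| < δ ∧
      max (g₁.eval x) (g₂.eval x) - δ <
        s₁.eval x ^ 2 * g₁.eval x + s₂.eval x ^ 2 * g₂.eval x := by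
  obtain ⟨G, hG⟩ : ∃ G, ∀ x ∈ Set.Icc A B, |g₁.eval x| + |g₂.eval x| ≤ G := by
    obtain ⟨G, hG⟩ := (isCompact_Icc (a := A) (b := B)).bddAbove_image
      (f := fun x ↦ |g₁.eval x| + |g₂.eval x|) (by fun_prop)
    exact ⟨G, fun x hx ↦ hG ⟨x, hx, rfl⟩⟩
  -- A continuous switch between `g₁` and `g₂`: it is clamped to `1` or `0` once they differ by `δ /
  -- 2`, and inside the transition zone either choice loses at most `δ / 2`.
  set w : ℝ → ℝ := fun x ↦ max 0 (min 1 (((g₁.eval x - g₂.eval x) / (δ / 2) + 1) / 2)) with hw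
  have hwc : Continuous w := by fun_prop
  have hw0 : ∀ x, 0 ≤ w x := fun x ↦ le_max_left _ _
  have hw1 : ∀ x, w x ≤ 1 := fun x ↦ max_le zero_le_one (min_le_left _ _)
  have hmax : ∀ x, max (g₁.eval x) (g₂.eval x) - δ / 2 ≤
      w x * g₁.eval x + (1 - w x) * g₂.eval x := fun x ↦ by
    rcases le_or_gt (δ / 2) (g₁.eval x - g₂.eval x) with h | h
    · have : w x = 1 := by
        have : 1 ≤ (g₁.eval x - g₂.eval x) / (δ / 2) := (one_le_div (by positivity)).2 h
        simp only [hw]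
        rw [min_eq_left (by linarith), max_eq_right zero_le_one]
      rw [this, max_eq_left (by linarith)]
      linarith
    rcases le_or_gt (δ / 2) (g₂.eval x - g₁.eval x) with h' | h'
    · have : w x = 0 := by
        have : (g₁.eval x - g₂.eval x) / (δ / 2) ≤ -1 := by
          rw [div_le_iff₀ (by positivity)]; linarith
        simp only [hw]
        exact max_eq_left ((min_le_right _ _).trans (by linarith))
      rw [this, max_eq_right (by linarith)]
      linarith
    · rw [sub_le_iff_le_add]
      have h0 := hw0 x
      have h1 := hw1 x
      refine max_le ?_ ?_ <;> nlinarith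
  -- Each squared approximation errs by at most `3 * η`; this choice makes both the total weight
  -- error and its effect on the `g_j`, bounded by `G`, smaller than needed.
  set η := min 1 (δ / (12 * (|G| + 1))) with hη
  have hη0 : 0 < η := lt_min one_pos (by positivity)
  have hη1 : η ≤ 1 := min_le_left _ _
  have hη2 : 12 * η * (|G| + 1) ≤ δ := by
    have : η ≤ δ / (12 * (|G| + 1)) := min_le_right _ _
    rw [le_div_iff₀ (by positivity)] at this
    linarith
  -- Weierstrass is applied to `√φ`, and `|s² - φ| = |s - √φ| * |s + √φ| ≤ η * (2 + η) ≤ 3 * η`.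
  have happ : ∀ φ : ℝ → ℝ, Continuous φ → (∀ x, 0 ≤ φ x) → (∀ x, φ x ≤ 1) →
      ∃ s : ℝ[X], ∀ x ∈ Set.Icc A B, |s.eval x ^ 2 - φ x| ≤ 3 * η := by
    intro φ hφ h0 h1
    obtain ⟨s, hs⟩ := exists_polynomial_near_of_continuousOn A B (fun x ↦ √(φ x))
      (by fun_prop) η hη0
    refine ⟨s, fun x hx ↦ ?_⟩
    have h := abs_lt.1 (hs x hx)
    have hr0 := Real.sqrt_nonneg (φ x)
    have hr1 : √(φ x) ≤ 1 := Real.sqrt_le_one.2 (h1 x)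
    have hr := Real.sq_sqrt (h0 x)
    rw [abs_le]
    constructor <;> nlinarith [h.1, h.2]
  obtain ⟨s₁, hs₁⟩ := happ w hwc hw0 hw1
  obtain ⟨s₂, hs₂⟩ := happ (fun x ↦ 1 - w x) (by fun_prop) (fun x ↦ by linarith [hw1 x])
    fun x ↦ by linarith [hw0 x]
  refine ⟨s₁, s₂, fun x hx ↦ ?_⟩
  have e₁ := hs₁ x hx
  have e₂ := hs₂ x hx
  have hGx := hG x hx
  have hηG : 3 * η * G < δ / 2 := by nlinarith [le_abs_self G]
  constructor
  · have : 12 * η ≤ δ := by nlinarith [abs_nonneg G]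
    rw [abs_le] at e₁ e₂
    rw [abs_lt]
    constructor <;> linarith [e₁.1, e₁.2, e₂.1, e₂.2]
  · have b₁ : -(3 * η * |g₁.eval x|) ≤ (s₁.eval x ^ 2 - w x) * g₁.eval x := by
      refine (abs_le.1 ?_).1
      rw [abs_mul]
      exact mul_le_mul_of_nonneg_right e₁ (abs_nonneg _)
    have b₂ : -(3 * η * |g₂.eval x|) ≤ (s₂.eval x ^ 2 - (1 - w x)) * g₂.eval x := by
      refine (abs_le.1 ?_).1
      rw [abs_mul]
      exact mul_le_mul_of_nonneg_right e₂ (abs_nonneg _)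
    have hle : 3 * η * (|g₁.eval x| + |g₂.eval x|) ≤ 3 * η * G :=
      mul_le_mul_of_nonneg_left hGx (by positivity)
    linarith [hmax x]

/-- If `q + max g₁ g₂ > 0` on `[A, B]`, then `y + q(z)` lies in every quadratic module containing
the constraints `A ≤ z ≤ B`, `τ₂ ≤ y ≤ τ₁` and `g₁(z), g₂(z) ≤ y`. -/
theorem add_aeval_mem_quadraticModule {S ι : Type*} [CommRing S] [Algebra ℝ S] [Fintype ι]
    {g : ι → S} (h1 : 1 ∈ quadraticModule g) {y z : S} {A B τ₁ τ₂ : ℝ} (hAB : A < B)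
    (hτ : τ₂ < τ₁) (hA : z - algebraMap ℝ S A ∈ quadraticModule g)
    (hB : algebraMap ℝ S B - z ∈ quadraticModule g)
    (hτ₁ : algebraMap ℝ S τ₁ - y ∈ quadraticModule g)
    (hτ₂ : y - algebraMap ℝ S τ₂ ∈ quadraticModule g) {g₁ g₂ : ℝ[X]}
    (hg₁ : y - aeval z g₁ ∈ quadraticModule g) (hg₂ : y - aeval z g₂ ∈ quadraticModule g)
    {q : ℝ[X]} (hq : ∀ x ∈ Set.Icc A B, 0 < q.eval x + max (g₁.eval x) (g₂.eval x)) :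
    y + aeval z q ∈ quadraticModule g := by
  obtain ⟨x₀, hx₀, hmin⟩ := (isCompact_Icc (a := A) (b := B)).exists_isMinOn
    (Set.nonempty_Icc.2 hAB.le)
    (f := fun x ↦ q.eval x + max (g₁.eval x) (g₂.eval x)) (by fun_prop)
  set m := q.eval x₀ + max (g₁.eval x₀) (g₂.eval x₀)
  have hm : 0 < m := hq x₀ hx₀
  set c := m / 2 with hc
  have hc0 : 0 < c := by positivity
  set T := max |τ₁| |τ₂|
  have hT0 : 0 ≤ T := le_max_of_le_left (abs_nonneg _)
  set δ := min c (c / (T + 1)) with hδ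
  have hδ0 : 0 < δ := lt_min hc0 (by positivity)
  obtain ⟨s₁, s₂, hs⟩ := exists_square_weights A B g₁ g₂ hδ0
  set e : ℝ[X] := 1 - s₁ * s₁ - s₂ * s₂ with he
  -- Chosen so that `c * K > T ^ 2`, which gives `y ^ 2 / (2 * K) < c / 2` for `|y| ≤ T`; the choice
  -- of `δ` gives `K * e ^ 2 < c`.
  set K := (T ^ 2 + 1) / c with hK
  have hK0 : 0 < K := by positivity
  have hu₁ : q + s₁ * s₁ * g₁ + s₂ * s₂ * g₂ - C c ∈ intervalModule A B := by
    refine mem_intervalModule_of_pos hAB fun x hx ↦ ?_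
    have h1 := (hs x hx).2
    have h2 : m ≤ q.eval x + max (g₁.eval x) (g₂.eval x) := hmin hx
    have h3 : δ ≤ c := min_le_left _ _
    simp only [eval_sub, eval_add, eval_mul, eval_C]
    linarith
  have hu₂ : C (c / 2) - C (K / 2) * (e * e) ∈ intervalModule A B := by
    refine mem_intervalModule_of_pos hAB fun x hx ↦ ?_
    have h1 := (hs x hx).1
    have h2 : δ * (T + 1) ≤ c := (le_div_iff₀ (by positivity)).1 (min_le_right _ _)
    have h3 : e.eval x = 1 - s₁.eval x ^ 2 - s₂.eval x ^ 2 := by simp [he]; ring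
    rw [← h3] at h1
    have h4 : |e.eval x| * (T + 1) < c :=
      (mul_lt_mul_of_pos_right h1 (by positivity)).trans_le h2
    have h5 : (|e.eval x| * (T + 1)) ^ 2 < c ^ 2 :=
      pow_lt_pow_left₀ h4 (by positivity) two_ne_zero
    rw [mul_pow, sq_abs] at h5
    have h6 : (T ^ 2 + 1) * e.eval x ^ 2 < c * c := by nlinarith [sq_nonneg (e.eval x)]
    have h7 : K * e.eval x ^ 2 < c := by
      rw [hK, div_mul_eq_mul_div, div_lt_iff₀ hc0]; exact h6
    simp only [eval_sub, eval_mul, eval_C]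
    linarith
  have hu₃ : C (c / 2) - C (1 / (2 * K)) * X ^ 2 ∈ intervalModule τ₂ τ₁ := by
    refine mem_intervalModule_of_pos hτ fun x hx ↦ ?_
    have h1 : |x| ≤ T := abs_le.2 ⟨by linarith [hx.1, neg_abs_le τ₂, le_max_right |τ₁| |τ₂|],
      by linarith [hx.2, le_abs_self τ₁, le_max_left |τ₁| |τ₂|]⟩
    have h2 : x ^ 2 ≤ T ^ 2 := sq_le_sq' (abs_le.1 h1).1 (abs_le.1 h1).2
    have h3 : c * K = T ^ 2 + 1 := by rw [hK]; field_simp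
    have h4 : 1 / (2 * K) * x ^ 2 < c / 2 := by
      rw [one_div_mul_eq_div, div_lt_iff₀ (by positivity)]
      linarith
    simp only [eval_sub, eval_mul, eval_C, eval_pow, eval_X]
    linarith
  have hsq : IsSumSq (algebraMap ℝ S (K / 2) *
      ((aeval z e + algebraMap ℝ S (1 / K) * y) * (aeval z e + algebraMap ℝ S (1 / K) * y))) := by
    refine IsSumSq.mul ?_ (.mul_self _)
    rw [← Real.mul_self_sqrt (show 0 ≤ K / 2 by positivity), map_mul]
    exact .mul_self _
  -- The six terms come from `y + q = s₁² (y - g₁) + s₂² (y - g₂) + (q + s₁² g₁ + s₂² g₂ - c) + (c +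
  -- e y)`. The mixed term is split by completing the square: `c + e y = (c/2 - K e²/2) + (c/2 -
  -- y²/(2K)) + (K/2) (e + y/K)²`. Everything beyond the generators and this square is univariate.
  have hmem := add_mem_quadraticModule (add_mem_quadraticModule
    (add_mem_quadraticModule
      (mul_mem_quadraticModule hg₁ (.mul_self (aeval z s₁)))
      (mul_mem_quadraticModule hg₂ (.mul_self (aeval z s₂))))
    (add_mem_quadraticModule (aeval_mem_quadraticModule h1 hA hB hu₁)
      (aeval_mem_quadraticModule h1 hA hB hu₂)))
    (add_mem_quadraticModule (aeval_mem_quadraticModule h1 hτ₂ hτ₁ hu₃)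
      (mul_mem_quadraticModule h1 hsq))
  have a1 : algebraMap ℝ S (K / 2) * algebraMap ℝ S (1 / K) * 2 = 1 := by
    rw [← map_mul, ← map_ofNat (algebraMap ℝ S) 2, ← map_mul, ← map_one (algebraMap ℝ S)]
    congr 1; field_simp
  have a2 : algebraMap ℝ S (1 / (2 * K)) =
      algebraMap ℝ S (K / 2) * algebraMap ℝ S (1 / K) * algebraMap ℝ S (1 / K) := by
    rw [← map_mul, ← map_mul]
    congr 1; field_simp
  have a3 : algebraMap ℝ S c = algebraMap ℝ S (c / 2) + algebraMap ℝ S (c / 2) := by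
    rw [← map_add, add_halves]
  convert hmem using 1
  simp only [map_sub, map_add, map_mul, map_pow, aeval_C, aeval_X, a2, a3, he, map_one]
  linear_combination (-y * (1 - aeval z s₁ * aeval z s₁ - aeval z s₂ * aeval z s₂)) * a1

end Certificates

/-! ### Offer prices as minima of two polynomials. -/

section Revenue

lemma lossPoly_eval_zero (a b d x : ℝ) :
    (lossPoly a b d 0).eval x = -(a * (x - b) ^ 3) - d := by
  simp [lossPoly]

lemma lossPoly_eval_one (a b d x : ℝ) : (lossPoly a b d 1).eval x = -d := by
  simp [lossPoly]

/-- The cubic `a * (x - b) ^ 3` changes sign exactly at the breakpoint `b`, so the maximum selects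
the right branch. -/
lemma max_lossPoly {a : ℝ} (ha : 0 < a) (b d x : ℝ) :
    max ((lossPoly a b d 0).eval x) ((lossPoly a b d 1).eval x) = -offerPrice a b d x := by
  rw [lossPoly_eval_zero, lossPoly_eval_one, offerPrice]
  split_ifs with h
  · have : (x - b) ^ 3 ≤ 0 := Odd.pow_nonpos (by decide) (sub_nonpos.2 h)
    have := mul_nonpos_of_nonneg_of_nonpos ha.le this
    rw [max_eq_left (by linarith)]; ring
  · have : 0 ≤ (x - b) ^ 3 := pow_nonneg (by linarith) 3
    have := mul_nonneg ha.le this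
    rw [max_eq_right (by linarith)]

lemma offerPrice_le_revenue {K : ℕ} (a b d : Fin K → ℝ) (x : ℝ) (k : Fin K) :
    offerPrice (a k) (b k) (d k) x ≤ revenue a b d x :=
  le_ciSup (f := fun k ↦ offerPrice (a k) (b k) (d k) x) (Set.finite_range _).bddAbove k

lemma continuous_revenue {K : ℕ} (hK : 0 < K) {a : Fin K → ℝ} (ha : ∀ k, 0 < a k)
    (b d : Fin K → ℝ) : Continuous (revenue a b d) := by
  have : Nonempty (Fin K) := ⟨⟨0, hK⟩⟩
  have h : revenue a b d = fun x ↦ Finset.univ.sup' Finset.univ_nonempty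
      fun k ↦ -max ((lossPoly (a k) (b k) (d k) 0).eval x) ((lossPoly (a k) (b k) (d k) 1).eval x) := by
    ext x
    simp_rw [max_lossPoly (ha _), neg_neg, Finset.sup'_univ_eq_ciSup]
    rfl
  rw [h]
  exact Continuous.finset_sup'_apply _ fun k _ ↦ by fun_prop

end Revenue

/-! ### The relaxations as truncated-module membership. -/

section Relaxation

open MvPolynomial

/-- The generators `1, h₁, h₂, g̃₁, …, g̃₄` of the lifted quadratic module of a customer. -/
noncomputable def generators (R a b d τ₁ τ₂ : ℝ) : Unit ⊕ (Fin 2 ⊕ Fin 4) → LiftedPoly :=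
  Sum.elim (fun _ ↦ 1) (Sum.elim (supportPoly R) (liftedPoly a b d τ₁ τ₂))

/-- The polynomial `ξ̃ + lam (ξ - x)^2 - α`. -/
noncomputable def dualPoly (lam x α : ℝ) : LiftedPoly :=
  xiTilde + C lam * (xi - C x) ^ 2 - C α

lemma eval_dualPoly (lam x α : ℝ) (z : Fin 2 → ℝ) :
    eval z (dualPoly lam x α) = z 1 + lam * (z 0 - x) ^ 2 - α := by
  simp [dualPoly, xi, xiTilde]

lemma totalDegree_dualPoly (lam x α : ℝ) : (dualPoly lam x α).totalDegree ≤ 2 := by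
  have h1 : (xi - C x).totalDegree ≤ 1 :=
    (totalDegree_sub _ _).trans (by simp [xi])
  have h2 : ((xi - C x) ^ 2).totalDegree ≤ 2 := (totalDegree_pow _ _).trans (by omega)
  have h3 : (C lam * (xi - C x) ^ 2).totalDegree ≤ 2 :=
    (totalDegree_mul _ _).trans (by rw [totalDegree_C]; omega)
  have h4 : (xiTilde + C lam * (xi - C x) ^ 2).totalDegree ≤ 2 :=
    (totalDegree_add _ _).trans (max_le (by simp [xiTilde]) h3)
  exact (totalDegree_sub _ _).trans (max_le h4 (by simp))

/-- The feasible pairs `(lam, α)` of the relaxation of order `r`. -/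
def feasiblePairs (R : ℝ) {K N : ℕ} (a b d τ₁ τ₂ : Fin K → ℝ) (data : Fin N → Set.Icc (0 : ℝ) R)
    (r : ℕ) : Set (ℝ × (Fin N → ℝ)) :=
  {y | 0 ≤ y.1 ∧ ∀ k i, dualPoly y.1 (data i) (y.2 i) ∈
    truncatedModule (generators R (a k) (b k) (d k) (τ₁ k) (τ₂ k)) r}

/-- The sum-of-squares remainder is just the multiplier of the generator `1`, so all multipliers can
be eliminated and only `(lam, α)` remains. -/
lemma relaxationValues_eq (R ε : ℝ) {K N : ℕ} (a b d τ₁ τ₂ : Fin K → ℝ)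
    (data : Fin N → Set.Icc (0 : ℝ) R) (r : ℕ) :
    relaxationValues R ε a b d τ₁ τ₂ data r =
      (fun y : ℝ × (Fin N → ℝ) ↦ y.1 * ε ^ 2 - (1 / (N : ℝ)) * ∑ i, y.2 i) ''
        feasiblePairs R a b d τ₁ τ₂ data r := by
  ext v
  constructor
  · rintro ⟨lam, α, σ, η, h, rfl⟩
    refine ⟨(lam, α), ⟨h.lam_nonneg, fun k i ↦ ?_⟩, rfl⟩
    refine ⟨Sum.elim (fun _ ↦ dualPoly lam (data i) (α i) - ∑ ℓ, σ k i ℓ * supportPoly R ℓ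
      - ∑ j, η k i j * liftedPoly (a k) (b k) (d k) (τ₁ k) (τ₂ k) j)
      (Sum.elim (σ k i) (η k i)), ?_, ?_, ?_⟩
    · rintro (_ | j | j)
      · exact h.isSumSq_remainder k i
      · exact h.isSumSq_σ k i j
      · exact h.isSumSq_η k i j
    · rintro (_ | j | j)
      · simp only [generators, Sum.elim_inl, mul_one]
        exact h.degree_remainder k i
      · exact h.degree_σ k i j
      · exact h.degree_η k i j
    · simp only [generators, Fintype.sum_sum_type, Sum.elim_inl, Sum.elim_inr, mul_one,
        Finset.univ_unique, Finset.sum_singleton]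
      ring
  · rintro ⟨⟨lam, α⟩, ⟨hlam, h⟩, rfl⟩
    choose s hs hd hsum using h
    have hrem : ∀ k i, dualPoly lam (data i) (α i)
        - ∑ ℓ, s k i (.inr (.inl ℓ)) * supportPoly R ℓ
        - ∑ j, s k i (.inr (.inr j)) * liftedPoly (a k) (b k) (d k) (τ₁ k) (τ₂ k) j =
          s k i (.inl ()) := fun k i ↦ by
      have := hsum k i
      simp only [generators, Fintype.sum_sum_type, Sum.elim_inl, Sum.elim_inr, mul_one,
        Finset.univ_unique, Finset.sum_singleton] at this
      rw [this]
      simp only [PUnit.default_eq_unit]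
      ring
    refine ⟨lam, α, fun k i ℓ ↦ s k i (.inr (.inl ℓ)), fun k i j ↦ s k i (.inr (.inr j)),
      ⟨hlam, fun k i ℓ ↦ hs k i _, fun k i j ↦ hs k i _, fun k i ↦ ?_, fun k i ↦ ?_,
        fun k i ℓ ↦ hd k i (.inr (.inl ℓ)), fun k i j ↦ hd k i (.inr (.inr j))⟩, rfl⟩
    · exact (hrem k i).symm ▸ hs k i (.inl ())
    · have := hd k i (.inl ())
      simp only [generators, Sum.elim_inl, mul_one] at this
      exact (hrem k i).symm ▸ this

lemma truncatedModule_mono {n : ℕ} {ι : Type*} [Fintype ι] (g : ι → MvPolynomial (Fin n) ℝ) :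
    Monotone (truncatedModule g) := by
  rintro r r' hr p ⟨s, hs, hd, rfl⟩
  exact ⟨s, hs, fun j ↦ (hd j).trans (by omega), rfl⟩

lemma exists_mem_truncatedModule {n : ℕ} {ι : Type*} [Fintype ι]
    {g : ι → MvPolynomial (Fin n) ℝ} {p : MvPolynomial (Fin n) ℝ} (hp : p ∈ quadraticModule g) :
    ∃ r, p ∈ truncatedModule g r := by
  obtain ⟨s, hs, rfl⟩ := hp
  refine ⟨∑ j, (s j * g j).totalDegree, s, hs, fun j ↦ ?_, rfl⟩
  have := Finset.single_le_sum (f := fun j ↦ (s j * g j).totalDegree) (fun _ _ ↦ Nat.zero_le _)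
    (Finset.mem_univ j)
  omega

lemma feasiblePairs_mono (R : ℝ) {K N : ℕ} (a b d τ₁ τ₂ : Fin K → ℝ)
    (data : Fin N → Set.Icc (0 : ℝ) R) : Monotone (feasiblePairs R a b d τ₁ τ₂ data) :=
  fun _ _ hr _ hy ↦ ⟨hy.1, fun k i ↦ truncatedModule_mono _ hr (hy.2 k i)⟩

lemma eval_aeval_xi (p : Polynomial ℝ) (z : Fin 2 → ℝ) :
    eval z (Polynomial.aeval xi p) = p.eval (z 0) := by
  rw [← MvPolynomial.coe_aeval_eq_eval, RingHom.coe_coe, ← Polynomial.aeval_algHom_apply]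
  simp [xi, Polynomial.aeval_def, Polynomial.eval₂_eq_eval_map]

lemma eval_generators {R a b d τ₁ τ₂ : ℝ} (z : Fin 2 → ℝ) :
    (eval z (generators R a b d τ₁ τ₂ (.inl ())) = 1 ∧
    eval z (generators R a b d τ₁ τ₂ (.inr (.inl 0))) = z 0 ∧
    eval z (generators R a b d τ₁ τ₂ (.inr (.inl 1))) = R - z 0) ∧
    eval z (generators R a b d τ₁ τ₂ (.inr (.inr 0))) = z 1 - (lossPoly a b d 0).eval (z 0) ∧
    eval z (generators R a b d τ₁ τ₂ (.inr (.inr 1))) = z 1 - (lossPoly a b d 1).eval (z 0) ∧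
    eval z (generators R a b d τ₁ τ₂ (.inr (.inr 2))) = τ₁ - z 1 ∧
    eval z (generators R a b d τ₁ τ₂ (.inr (.inr 3))) = z 1 - τ₂ := by
  simp only [generators, supportPoly, liftedPoly, Sum.elim_inl, Sum.elim_inr]
  simp [eval_aeval_xi]
  simp [xiTilde, xi]

lemma forall_generators {P : Unit ⊕ (Fin 2 ⊕ Fin 4) → Prop} :
    (∀ j, P j) ↔ (P (.inl ()) ∧ P (.inr (.inl 0)) ∧ P (.inr (.inl 1))) ∧ P (.inr (.inr 0)) ∧
      P (.inr (.inr 1)) ∧ P (.inr (.inr 2)) ∧ P (.inr (.inr 3)) := by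
  constructor
  · exact fun h ↦ ⟨⟨h _, h _, h _⟩, h _, h _, h _, h _⟩
  · rintro ⟨⟨h1, h2, h3⟩, h4, h5, h6, h7⟩ (_ | j | j)
    · exact h1
    · fin_cases j
      exacts [h2, h3]
    · fin_cases j
      exacts [h4, h5, h6, h7]

variable {R a b d τ₁ τ₂ : ℝ}

/-- The interior point required for closedness: the midpoint of `[0, R]`, with a height strictly
between the two loss polynomials and `τ₁`. -/
lemma exists_generators_pos (hR : 0 < R)
    (hτ₁ : ∀ x ∈ Set.Icc (0 : ℝ) R, ∀ j, (lossPoly a b d j).eval x < τ₁)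
    (hτ₂ : ∀ x ∈ Set.Icc (0 : ℝ) R, ∀ j, τ₂ < (lossPoly a b d j).eval x) :
    ∃ z, ∀ j, 0 < eval z (generators R a b d τ₁ τ₂ j) := by
  have hx : R / 2 ∈ Set.Icc (0 : ℝ) R := ⟨by linarith, by linarith⟩
  obtain ⟨y, hy, hy'⟩ := exists_between (max_lt (hτ₁ _ hx 0) (hτ₁ _ hx 1))
  rw [max_lt_iff] at hy
  refine ⟨![R / 2, y], forall_generators.2 ?_⟩
  obtain ⟨⟨e1, e2, e3⟩, e4, e5, e6, e7⟩ :=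
    eval_generators (R := R) (a := a) (b := b) (d := d) (τ₁ := τ₁) (τ₂ := τ₂) ![R / 2, y]
  rw [e1, e2, e3, e4, e5, e6, e7]
  simp only [Matrix.cons_val_zero, Matrix.cons_val_one]
  refine ⟨⟨one_pos, by linarith, by linarith⟩, by linarith [hy.1], by linarith [hy.2],
    by linarith, by linarith [hy.1, hτ₂ _ hx 0]⟩

/-- Membership of `ξ̃ + lam (ξ - x)^2 - α` in the quadratic module bounds the offer price. -/
lemma offerPrice_le_of_mem (ha : 0 < a) (hτ₁ : ∀ x ∈ Set.Icc (0 : ℝ) R, ∀ j,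
      (lossPoly a b d j).eval x < τ₁)
    (hτ₂ : ∀ x ∈ Set.Icc (0 : ℝ) R, ∀ j, τ₂ < (lossPoly a b d j).eval x) {r : ℕ}
    {lam x₀ α : ℝ} (h : dualPoly lam x₀ α ∈ truncatedModule (generators R a b d τ₁ τ₂) r)
    {x : ℝ} (hx : x ∈ Set.Icc (0 : ℝ) R) :
    offerPrice a b d x ≤ lam * (x - x₀) ^ 2 - α := by
  -- The lowest admissible height over `x`, which makes the evaluation tight: there `y` is minus the
  -- offer price.
  set y := max ((lossPoly a b d 0).eval x) ((lossPoly a b d 1).eval x) with hy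
  have hnn : ∀ j, 0 ≤ eval ![x, y] (generators R a b d τ₁ τ₂ j) := by
    refine forall_generators.2 ?_
    obtain ⟨⟨e1, e2, e3⟩, e4, e5, e6, e7⟩ :=
      eval_generators (R := R) (a := a) (b := b) (d := d) (τ₁ := τ₁) (τ₂ := τ₂) ![x, y]
    rw [e1, e2, e3, e4, e5, e6, e7]
    simp only [Matrix.cons_val_zero, Matrix.cons_val_one]
    have h1 := le_max_left ((lossPoly a b d 0).eval x) ((lossPoly a b d 1).eval x)
    have h2 := le_max_right ((lossPoly a b d 0).eval x) ((lossPoly a b d 1).eval x)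
    have h3 := max_lt (hτ₁ _ hx 0) (hτ₁ _ hx 1)
    exact ⟨⟨zero_le_one, hx.1, by linarith [hx.2]⟩, by linarith, by linarith, by linarith,
      by linarith [hτ₂ _ hx 0]⟩
  obtain ⟨s, hs, -, hsum⟩ := h
  have hev : 0 ≤ eval ![x, y] (dualPoly lam x₀ α) := by
    rw [hsum, map_sum]
    refine Finset.sum_nonneg fun j _ ↦ ?_
    rw [map_mul]
    exact mul_nonneg (mvPolynomial_eval_nonneg_of_isSumSq (hs j) _) (hnn j)
  rw [eval_dualPoly, hy, max_lossPoly ha] at hev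
  simp only [Matrix.cons_val_zero, Matrix.cons_val_one] at hev
  linarith

/-- A strict bound on the offer price is certified by some relaxation order. -/
lemma exists_mem_truncatedModule_of_offerPrice_lt (hR : 0 < R) (ha : 0 < a)
    (hτ₁ : ∀ x ∈ Set.Icc (0 : ℝ) R, ∀ j, (lossPoly a b d j).eval x < τ₁)
    (hτ₂ : ∀ x ∈ Set.Icc (0 : ℝ) R, ∀ j, τ₂ < (lossPoly a b d j).eval x) {lam x₀ α : ℝ}
    (h : ∀ x ∈ Set.Icc (0 : ℝ) R, offerPrice a b d x < lam * (x - x₀) ^ 2 - α) :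
    ∃ r, dualPoly lam x₀ α ∈ truncatedModule (generators R a b d τ₁ τ₂) r := by
  have hself := self_mem_quadraticModule (generators R a b d τ₁ τ₂)
  have h0 : (0 : ℝ) ∈ Set.Icc (0 : ℝ) R := ⟨le_rfl, hR.le⟩
  have hmem := add_aeval_mem_quadraticModule (g := generators R a b d τ₁ τ₂)
    (hself (.inl ())) (y := xiTilde) (z := xi) (A := 0) (B := R) (τ₁ := τ₁) (τ₂ := τ₂) hR
    ((hτ₂ 0 h0 0).trans (hτ₁ 0 h0 0))
    (by rw [map_zero, sub_zero]; exact hself (.inr (.inl 0))) (hself (.inr (.inl 1)))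
    (hself (.inr (.inr 2))) (hself (.inr (.inr 3))) (hself (.inr (.inr 0)))
    (hself (.inr (.inr 1)))
    (q := Polynomial.C lam * (Polynomial.X - Polynomial.C x₀) ^ 2 - Polynomial.C α)
    fun x hx ↦ by
      rw [max_lossPoly ha]
      simp only [Polynomial.eval_sub, Polynomial.eval_mul, Polynomial.eval_pow,
        Polynomial.eval_C, Polynomial.eval_X]
      linarith [h x hx]
  have heq : xiTilde + Polynomial.aeval xi
      (Polynomial.C lam * (Polynomial.X - Polynomial.C x₀) ^ 2 - Polynomial.C α) =
      dualPoly lam x₀ α := by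
    simp [dualPoly, MvPolynomial.algebraMap_eq, add_sub_assoc]
  rw [heq] at hmem
  exact exists_mem_truncatedModule hmem

/-- Writing `ξ̃ - c = (τ₂ - c) + (ξ̃ - τ₂)` uses a constant square and the last generator; this
provides a feasible point from order `1` on. -/
lemma dualPoly_zero_mem_truncatedModule {c : ℝ} (hc : c ≤ τ₂) (x₀ : ℝ) {r : ℕ} (hr : 1 ≤ r) :
    dualPoly 0 x₀ c ∈ truncatedModule (generators R a b d τ₁ τ₂) r := by
  refine ⟨Sum.elim (fun _ ↦ C √(τ₂ - c) * C √(τ₂ - c))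
    (Sum.elim (fun _ ↦ 0) fun j ↦ if j = 3 then 1 else 0), ?_, ?_, ?_⟩
  · rintro (_ | j | j)
    · exact .mul_self _
    · exact .zero
    · dsimp only [Sum.elim_inr]
      split_ifs
      exacts [.one, .zero]
  · rintro (_ | j | j)
    · simp only [generators, Sum.elim_inl, mul_one]
      rw [← C_mul, totalDegree_C]
      exact Nat.zero_le _
    · simp
    · dsimp only [Sum.elim_inr]
      split_ifs with h
      · subst h
        simp only [generators, Sum.elim_inr, one_mul, liftedPoly]
        refine (totalDegree_sub _ _).trans (max_le ?_ ?_)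
        · simp only [xiTilde, totalDegree_X]; omega
        · simp
      · simp
  · simp only [generators, Fintype.sum_sum_type, Sum.elim_inl, Sum.elim_inr, mul_one,
      Finset.univ_unique, Finset.sum_singleton, ← C_mul, Real.mul_self_sqrt (sub_nonneg.2 hc)]
    simp [dualPoly, liftedPoly]

end Relaxation

/-! ### Attained optima and approximation of dual solutions. -/

section Attainment

variable {R ε : ℝ} {K N : ℕ} {a b d τ₁ τ₂ : Fin K → ℝ} {data : Fin N → Set.Icc (0 : ℝ) R}

lemma revenue_le_of_mem_feasiblePairs (hK : 0 < K) (ha : ∀ k, 0 < a k)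
    (hτ₁ : ∀ k, ∀ x ∈ Set.Icc (0 : ℝ) R, ∀ j, (lossPoly (a k) (b k) (d k) j).eval x < τ₁ k)
    (hτ₂ : ∀ k, ∀ x ∈ Set.Icc (0 : ℝ) R, ∀ j, τ₂ k < (lossPoly (a k) (b k) (d k) j).eval x)
    {r : ℕ} {y : ℝ × (Fin N → ℝ)} (hy : y ∈ feasiblePairs R a b d τ₁ τ₂ data r) (i : Fin N)
    (x : Set.Icc (0 : ℝ) R) :
    revenue a b d x ≤ y.1 * dist x (data i) ^ 2 - y.2 i := by
  have : Nonempty (Fin K) := ⟨⟨0, hK⟩⟩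
  rw [Subtype.dist_eq, Real.dist_eq, sq_abs]
  exact ciSup_le fun k ↦ offerPrice_le_of_mem (ha k) (hτ₁ k) (hτ₂ k) (hy.2 k i) x.2

lemma isClosed_feasiblePairs (hR : 0 < R)
    (hτ₁ : ∀ k, ∀ x ∈ Set.Icc (0 : ℝ) R, ∀ j, (lossPoly (a k) (b k) (d k) j).eval x < τ₁ k)
    (hτ₂ : ∀ k, ∀ x ∈ Set.Icc (0 : ℝ) R, ∀ j, τ₂ k < (lossPoly (a k) (b k) (d k) j).eval x)
    {r : ℕ} (hr : 1 ≤ r) : IsClosed (feasiblePairs R a b d τ₁ τ₂ data r) := by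
  have h : feasiblePairs R a b d τ₁ τ₂ data r =
      {y : ℝ × (Fin N → ℝ) | 0 ≤ y.1} ∩ ⋂ k, ⋂ i, {y | dualPoly y.1 (data i) (y.2 i) ∈
        truncatedModule (generators R (a k) (b k) (d k) (τ₁ k) (τ₂ k)) r} := by
    ext y; simp [feasiblePairs]
  rw [h]
  refine (isClosed_le continuous_const continuous_fst).inter
    (isClosed_iInter fun k ↦ isClosed_iInter fun i ↦ ?_)
  refine isClosed_setOf_mem_truncatedModule _ (exists_generators_pos hR (hτ₁ k) (hτ₂ k)) r _
    (fun x ↦ ?_) fun y ↦ (totalDegree_dualPoly _ _ _).trans (by omega)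
  simp only [eval_dualPoly]
  fun_prop

/-- The minimum of the relaxation of order `r ≥ 1` is attained. -/
theorem exists_isLeast_relaxationValues (hK : 0 < K) (hN : 0 < N) (hR : 0 < R) (hε : 0 < ε)
    (ha : ∀ k, 0 < a k)
    (hτ₁ : ∀ k, ∀ x ∈ Set.Icc (0 : ℝ) R, ∀ j, (lossPoly (a k) (b k) (d k) j).eval x < τ₁ k)
    (hτ₂ : ∀ k, ∀ x ∈ Set.Icc (0 : ℝ) R, ∀ j, τ₂ k < (lossPoly (a k) (b k) (d k) j).eval x)
    {r : ℕ} (hr : 1 ≤ r) : ∃ m, IsLeast (relaxationValues R ε a b d τ₁ τ₂ data r) m := by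
  have hN' : (0 : ℝ) < N := by exact_mod_cast hN
  set obj : ℝ × (Fin N → ℝ) → ℝ := fun y ↦ y.1 * ε ^ 2 - (1 / (N : ℝ)) * ∑ i, y.2 i with hobj
  have hobjc : Continuous obj := by fun_prop
  obtain ⟨c, hc⟩ := (Set.finite_range τ₂).bddBelow
  have hy₀ : ((0 : ℝ), fun _ : Fin N ↦ c) ∈ feasiblePairs R a b d τ₁ τ₂ data r :=
    ⟨le_rfl, fun k i ↦ dualPoly_zero_mem_truncatedModule (hc ⟨k, rfl⟩) _ hr⟩
  set M := obj (0, fun _ ↦ c)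
  set B : Fin N → ℝ := fun i ↦ -revenue a b d (data i) with hB
  set L := ∑ i, B i + N * M with hL
  -- Evaluating the dual constraint at the data point itself gives `α i ≤ B i`. With this upper
  -- bound, an objective at most `M` bounds `lam` above, since `ε > 0`, and each `α i` below.
  have hbox : feasiblePairs R a b d τ₁ τ₂ data r ∩ {y | obj y ≤ M} ⊆
      Set.Icc 0 (L / (N * ε ^ 2)) ×ˢ Set.univ.pi fun i ↦ Set.Icc (B i - L) (B i) := by
    rintro y ⟨hy, hyM⟩
    have hlam : 0 ≤ y.1 := hy.1
    have hα : ∀ i, y.2 i ≤ B i := fun i ↦ by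
      have := revenue_le_of_mem_feasiblePairs hK ha hτ₁ hτ₂ hy i (data i)
      rw [dist_self] at this
      simp only [hB]
      linarith
    have hyM' : y.1 * (N * ε ^ 2) - ∑ i, y.2 i ≤ N * M := by
      have := mul_le_mul_of_nonneg_left (show obj y ≤ M from hyM) hN'.le
      have h2 : (N : ℝ) * obj y = y.1 * (N * ε ^ 2) - ∑ i, y.2 i := by
        simp only [hobj]; field_simp
      rwa [h2] at this
    have hpos : 0 ≤ y.1 * (N * ε ^ 2) := by positivity
    have hsum : ∑ i, (B i - y.2 i) ≤ L := by
      rw [Finset.sum_sub_distrib]; linarith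
    refine ⟨⟨hlam, ?_⟩, fun i _ ↦ ⟨?_, hα i⟩⟩
    · rw [le_div_iff₀ (by positivity)]
      have := Finset.sum_le_sum fun i (_ : i ∈ Finset.univ) ↦ hα i
      linarith
    · have := Finset.single_le_sum (f := fun i ↦ B i - y.2 i)
        (fun i _ ↦ sub_nonneg.2 (hα i)) (Finset.mem_univ i)
      linarith
  have hcomp : IsCompact (feasiblePairs R a b d τ₁ τ₂ data r ∩ {y | obj y ≤ M}) :=
    (isCompact_Icc.prod (isCompact_univ_pi fun _ ↦ isCompact_Icc)).of_isClosed_subset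
      ((isClosed_feasiblePairs hR hτ₁ hτ₂ hr).inter (isClosed_le hobjc continuous_const)) hbox
  obtain ⟨y, ⟨hy, hyM⟩, hmin⟩ := hcomp.exists_isMinOn ⟨_, hy₀, le_refl M⟩ hobjc.continuousOn
  refine ⟨obj y, ?_⟩
  rw [relaxationValues_eq]
  refine ⟨⟨y, hy, rfl⟩, ?_⟩
  rintro _ ⟨z, hz, rfl⟩
  rcases le_total (obj z) M with h | h
  · exact hmin ⟨hz, h⟩
  · exact le_trans hyM h

/-- Optimal dual solution of the worst-case revenue problem. -/
theorem exists_worstCase_revenue (hK : 0 < K) (hN : 0 < N) (hε : 0 < ε) (ha : ∀ k, 0 < a k) :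
    ∃ v, IsGreatest (expectedRevenues R ε a b d data) v ∧ ∃ (lam : ℝ) (α : Fin N → ℝ), 0 ≤ lam ∧
      (∀ i (x : Set.Icc (0 : ℝ) R), revenue a b d x ≤ lam * dist x (data i) ^ 2 - α i) ∧
      lam * ε ^ 2 - (1 / (N : ℝ)) * ∑ i, α i ≤ v := by
  have hf : Continuous fun x : Set.Icc (0 : ℝ) R ↦ revenue a b d x :=
    (continuous_revenue hK ha b d).comp continuous_subtype_val
  obtain ⟨Q, hQ, lam, hlam, hle⟩ := exists_worstCase_and_multiplier hN hf hε data
  -- The multiplier inequality holds for all tuples, so the atoms can be optimised independently;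
  -- the maximal values are the `-α i`.
  have hmax : ∀ i, ∃ z : Set.Icc (0 : ℝ) R, ∀ x : Set.Icc (0 : ℝ) R,
      revenue a b d x - lam * dist x (data i) ^ 2 ≤ revenue a b d z - lam * dist z (data i) ^ 2 :=
    fun i ↦ by
      obtain ⟨z, -, hz⟩ := isCompact_univ.exists_isMaxOn ⟨data i, Set.mem_univ _⟩
        (f := fun x : Set.Icc (0 : ℝ) R ↦ revenue a b d x - lam * dist x (data i) ^ 2)
        (by fun_prop)
      exact ⟨z, fun x ↦ hz (Set.mem_univ x)⟩
  choose z hz using hmax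
  set α : Fin N → ℝ := fun i ↦ -(revenue a b d (z i) - lam * dist (z i) (data i) ^ 2) with hα
  have hα1 : ∀ i (x : Set.Icc (0 : ℝ) R),
      revenue a b d x ≤ lam * dist x (data i) ^ 2 - α i := fun i x ↦ by
    simp only [hα]
    linarith [hz i x]
  have hα2 : lam * ε ^ 2 - (1 / (N : ℝ)) * ∑ i, α i ≤ ∫ x, revenue a b d x ∂Q := by
    have := hle z
    simp only [hα, Finset.sum_neg_distrib]
    linarith
  refine ⟨_, ⟨⟨Q, hQ, rfl⟩, ?_⟩, lam, α, hlam, hα1, hα2⟩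
  rintro _ ⟨Q', hQ', rfl⟩
  exact (integral_le_dual hN hf hε data hQ' hlam hα1).trans hα2

lemma relaxationValues_mono : Monotone (relaxationValues R ε a b d τ₁ τ₂ data) := fun r r' hr ↦ by
  simp only [relaxationValues_eq]
  exact Set.image_mono (feasiblePairs_mono R a b d τ₁ τ₂ data hr)

/-- Every relaxation value bounds every expected revenue. -/
theorem expectedRevenues_le_relaxationValues (hK : 0 < K) (hN : 0 < N) (hε : 0 < ε)
    (ha : ∀ k, 0 < a k)
    (hτ₁ : ∀ k, ∀ x ∈ Set.Icc (0 : ℝ) R, ∀ j, (lossPoly (a k) (b k) (d k) j).eval x < τ₁ k)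
    (hτ₂ : ∀ k, ∀ x ∈ Set.Icc (0 : ℝ) R, ∀ j, τ₂ k < (lossPoly (a k) (b k) (d k) j).eval x)
    {r : ℕ} {v w : ℝ} (hv : v ∈ expectedRevenues R ε a b d data)
    (hw : w ∈ relaxationValues R ε a b d τ₁ τ₂ data r) : v ≤ w := by
  rw [relaxationValues_eq] at hw
  obtain ⟨y, hy, rfl⟩ := hw
  obtain ⟨Q, hQ, rfl⟩ := hv
  exact integral_le_dual hN ((continuous_revenue hK ha b d).comp continuous_subtype_val) hε data hQ
    hy.1 (revenue_le_of_mem_feasiblePairs hK ha hτ₁ hτ₂ hy)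

/-- Dual solutions are approximated by feasible points of the relaxations. -/
theorem exists_relaxationValue_eq (hR : 0 < R) (ha : ∀ k, 0 < a k)
    (hτ₁ : ∀ k, ∀ x ∈ Set.Icc (0 : ℝ) R, ∀ j, (lossPoly (a k) (b k) (d k) j).eval x < τ₁ k)
    (hτ₂ : ∀ k, ∀ x ∈ Set.Icc (0 : ℝ) R, ∀ j, τ₂ k < (lossPoly (a k) (b k) (d k) j).eval x)
    {lam : ℝ} (hlam : 0 ≤ lam) {α : Fin N → ℝ}
    (hα : ∀ i (x : Set.Icc (0 : ℝ) R), revenue a b d x < lam * dist x (data i) ^ 2 - α i) :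
    ∃ r, lam * ε ^ 2 - (1 / (N : ℝ)) * ∑ i, α i ∈ relaxationValues R ε a b d τ₁ τ₂ data r := by
  have h : ∀ k i, ∃ r, dualPoly lam (data i) (α i) ∈
      truncatedModule (generators R (a k) (b k) (d k) (τ₁ k) (τ₂ k)) r := fun k i ↦ by
    refine exists_mem_truncatedModule_of_offerPrice_lt hR (ha k) (hτ₁ k) (hτ₂ k) fun x hx ↦ ?_
    have := hα i ⟨x, hx⟩
    rw [Subtype.dist_eq, Real.dist_eq, sq_abs] at this
    exact (offerPrice_le_revenue a b d x k).trans_lt this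
  choose r hr using h
  refine ⟨∑ k, ∑ i, r k i, ?_⟩
  rw [relaxationValues_eq]
  refine ⟨(lam, α), ⟨hlam, fun k i ↦ truncatedModule_mono _ ?_ (hr k i)⟩, rfl⟩
  exact (Finset.single_le_sum (f := fun i ↦ r k i) (fun _ _ ↦ Nat.zero_le _)
    (Finset.mem_univ i)).trans (Finset.single_le_sum (f := fun k ↦ ∑ i, r k i)
    (fun _ _ ↦ Nat.zero_le _) (Finset.mem_univ k))

end Attainment

end RevenueEstimation

/-! ### Convergence of the hierarchy. -/

theorem proposition5p1 (K N : ℕ) (hK : 0 < K) (hN : 0 < N) (R ε : ℝ) (hR : 0 < R) (hε : 0 < ε)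
    (a b d : Fin K → ℝ) (ha : ∀ k, 0 < a k) (hb : ∀ k, 0 ≤ b k) (hd : ∀ k, 0 ≤ d k)
    (habd : ∀ k, 0 ≤ -(a k * b k ^ 3) + d k)
    (data : Fin N → Set.Icc (0 : ℝ) R)
    (τ₁ τ₂ : Fin K → ℝ)
    (hτ₁ : ∀ k, ∀ x ∈ Set.Icc (0 : ℝ) R, ∀ j,
      (RevenueEstimation.lossPoly (a k) (b k) (d k) j).eval x < τ₁ k)
    (hτ₂ : ∀ k, ∀ x ∈ Set.Icc (0 : ℝ) R, ∀ j,
      τ₂ k < (RevenueEstimation.lossPoly (a k) (b k) (d k) j).eval x) :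
    ∃ (maxRP : ℝ) (minRD : ℕ → ℝ),
      IsGreatest (RevenueEstimation.expectedRevenues R ε a b d data) maxRP ∧
      (∀ r, 2 ≤ r →
        IsLeast (RevenueEstimation.relaxationValues R ε a b d τ₁ τ₂ data r) (minRD r)) ∧
      (∀ r, 2 ≤ r → minRD (r + 1) ≤ minRD r ∧ maxRP ≤ minRD (r + 1)) ∧
      Tendsto minRD atTop (𝓝 maxRP) := by
  obtain ⟨v, hv, lam, α, hlam, hα, hαv⟩ :=
    RevenueEstimation.exists_worstCase_revenue (R := R) (b := b) (d := d) (data := data) hK hN hε ha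
  have hleast : ∀ r, ∃ m, 2 ≤ r →
      IsLeast (RevenueEstimation.relaxationValues R ε a b d τ₁ τ₂ data r) m := fun r ↦ by
    by_cases hr : 2 ≤ r
    · obtain ⟨m, hm⟩ := RevenueEstimation.exists_isLeast_relaxationValues (data := data) hK hN hR
        hε ha hτ₁ hτ₂ (show 1 ≤ r by omega)
      exact ⟨m, fun _ ↦ hm⟩
    -- The value below order `2` is arbitrary and does not affect the limit.
    · exact ⟨0, fun h ↦ absurd h hr⟩
  choose m hm using hleast
  have hlower : ∀ r, 2 ≤ r → v ≤ m r := fun r hr ↦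
    RevenueEstimation.expectedRevenues_le_relaxationValues hK hN hε ha hτ₁ hτ₂ hv.1 (hm r hr).1
  refine ⟨v, m, hv, hm, fun r hr ↦ ⟨?_, hlower _ (by omega)⟩, ?_⟩
  · exact (hm (r + 1) (by omega)).2
      (RevenueEstimation.relaxationValues_mono (Nat.le_succ r) (hm r hr).1)
  · rw [Metric.tendsto_atTop]
    intro δ hδ
    -- Lowering every `α i` by `δ / 2` makes the constraints strict, as the certificates require,
    -- and raises the objective by only `δ / 2`.
    obtain ⟨r, hr⟩ := RevenueEstimation.exists_relaxationValue_eq (ε := ε) (data := data)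
      hR ha hτ₁ hτ₂ hlam (α := fun i ↦ α i - δ / 2) fun i x ↦ (hα i x).trans_lt (by linarith)
    refine ⟨max r 2, fun s hs ↦ ?_⟩
    have hs2 : 2 ≤ s := (le_max_right _ _).trans hs
    have hupper := (hm s hs2).2
      (RevenueEstimation.relaxationValues_mono ((le_max_left _ _).trans hs) hr)
    have hN' : (N : ℝ) ≠ 0 := by exact_mod_cast hN.ne'
    have hval : (1 / (N : ℝ)) * ∑ i, (α i - δ / 2) = (1 / (N : ℝ)) * ∑ i, α i - δ / 2 := by
      rw [Finset.sum_sub_distrib, Finset.sum_const, Finset.card_univ, Fintype.card_fin,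
        nsmul_eq_mul]
      field_simp
    rw [hval] at hupper
    rw [Real.dist_eq, abs_of_nonneg (sub_nonneg.2 (hlower s hs2))]
    linarith
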